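/- Let $k$ be an algebraically closed field of characteristic zero, complete with respect to a nontrivial absolute value (e.g. $k=\mathbb C$), let $n\ge 0$, and let $\mathcal O_n$ be one of the following rings of functions on the germ $(k^n,0)$: the rational functions regular at the origin $k[x_1,\dots,x_n]_{(\mathfrak m)}$, the locally converging power series $k\{x_1,\dots,x_n\}$, or the formal power series $k[[x_1,\dots,x_n]]$. A determinantal representation of a hypersurface germ $(X,0)=\{F=0\}$, $F\in\mathcal O_n$, is a square matrix $\mathcal M$ of some size $d\times d$ with entries in $\mathcal O_n$, vanishing at the origin, with $\det\mathcal M=uF$ for a unit $u\in\mathcal O_n$. Two such matrices are equivalent if $\mathcal N=A\mathcal M B$ for some $A,B\in GL(d,\mathcal O_n)$ (in particular they have the same size). The representation is maximally generated near the origin if $\operatorname{corank}\mathcal M|_{pt}=\operatorname{mult}(X,pt)$, the order of vanishing of $\det\mathcal M$ at $pt$, for all points $pt$ of some neighbourhood of $0\in k^n$. For $\mathcal O_n=k[[x_1,\dots,x_n]]$ the points $pt$ are all the points $\mathfrak p$ of $\operatorname{Spec}\mathcal O_n$: the corank is taken over the residue field of $\mathfrak p$, and the order of vanishing is the order with respect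 to the maximal ideal of the local ring $(\mathcal O_n)_{\mathfrak p}$. Let $(X,0)=\bigcup_{\alpha=1}^r(X_\alpha,0)$, $(X_\alpha,0)=\{f_\alpha=0\}$ with $f_\alpha\in\mathcal O_n$, be the reduced union $\{\prod_\alpha f_\alpha=0\}$ of smooth hypersurface germs (i.e. $f_\alpha(0)=0$ and the linear part of $f_\alpha$ is not zero) that are pairwise non-tangent (i.e. for $\alpha\ne\beta$ the tangent hyperplanes of $X_\alpha$ and $X_\beta$ at the origin are different); for example, an arrangement of pairwise distinct hyperplanes through the origin. Then the diagonal matrix $\operatorname{diag}(f_1,\dots,f_r)$ is a determinantal representation of $(X,0)$ that is maximally generated near the origin, and every determinantal representation of $(X,0)$ that is maximally generated near the origin is equivalent to $\operatorname{diag}(f_1,\dots,f_r)$ (in particular it has size $r\times r$). -/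

import Mathlib

open Filter Topology

noncomputable section

namespace DetRep

/-! ### The three rings of functions on `(kⁿ, 0)` -/

section Rings

variable (k : Type*) [NontriviallyNormedField k] (n : ℕ)

/-- Germs at the origin of arbitrary functions `kⁿ → k`. -/
abbrev FunGerm : Type _ := Germ (𝓝 (0 : Fin n → k)) k

/-- The ring `k{x₁, …, xₙ}` of locally converging power series, as the ring of germs at the origin
of functions that are sums of a converging power series near the origin. -/
def analyticGerms : Subring (FunGerm k n) where
  carrier := {φ | ∃ g : (Fin n → k) → k, AnalyticAt k g 0 ∧ φ = (g : FunGerm k n)}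
  mul_mem' := by
    rintro _ _ ⟨g, hg, rfl⟩ ⟨h, hh, rfl⟩
    exact ⟨g * h, hg.mul hh, rfl⟩
  one_mem' := ⟨1, analyticAt_const, rfl⟩
  add_mem' := by
    rintro _ _ ⟨g, hg, rfl⟩ ⟨h, hh, rfl⟩
    exact ⟨g + h, hg.add hh, rfl⟩
  zero_mem' := ⟨0, analyticAt_const, rfl⟩
  neg_mem' := by
    rintro _ ⟨g, hg, rfl⟩
    exact ⟨-g, hg.neg, rfl⟩

theorem eventually_eval_ne_zero {k : Type*} [NontriviallyNormedField k] {n : ℕ}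
    {q : MvPolynomial (Fin n) k} (hq : MvPolynomial.eval 0 q ≠ 0) :
    ∀ᶠ x : Fin n → k in 𝓝 0, MvPolynomial.eval x q ≠ 0 :=
  (MvPolynomial.continuous_eval q).continuousAt.eventually_ne hq

/-- The ring `k[x₁, …, xₙ]_(𝔪)` of rational functions that are regular at the origin, as the ring
of the germs of the quotients `p / q` of polynomials with `q(0) ≠ 0`. -/
def rationalGerms : Subring (FunGerm k n) where
  carrier := {φ | ∃ p q : MvPolynomial (Fin n) k, MvPolynomial.eval 0 q ≠ 0 ∧
    φ = ((fun x => MvPolynomial.eval x p / MvPolynomial.eval x q : (Fin n → k) → k) :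
      FunGerm k n)}
  mul_mem' := by
    rintro _ _ ⟨p, q, hq, rfl⟩ ⟨p', q', hq', rfl⟩
    refine ⟨p * p', q * q', by rw [map_mul]; exact mul_ne_zero hq hq', ?_⟩
    rw [← Germ.coe_mul, Germ.coe_eq]
    exact Eventually.of_forall fun x => by simp [div_mul_div_comm]
  one_mem' := ⟨1, 1, by simp, by
    rw [← Germ.coe_one, Germ.coe_eq]
    exact Eventually.of_forall fun x => by simp⟩
  add_mem' := by
    rintro _ _ ⟨p, q, hq, rfl⟩ ⟨p', q', hq', rfl⟩
    refine ⟨p * q' + q * p', q * q', by rw [map_mul]; exact mul_ne_zero hq hq', ?_⟩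
    rw [← Germ.coe_add, Germ.coe_eq]
    filter_upwards [eventually_eval_ne_zero hq, eventually_eval_ne_zero hq'] with x hx hx'
    simp [div_add_div _ _ hx hx']
  zero_mem' := ⟨0, 1, by simp, by
    rw [← Germ.coe_zero, Germ.coe_eq]
    exact Eventually.of_forall fun x => by simp⟩
  neg_mem' := by
    rintro _ ⟨p, q, hq, rfl⟩
    refine ⟨-p, q, hq, ?_⟩
    rw [← Germ.coe_neg, Germ.coe_eq]
    exact Eventually.of_forall fun x => by simp [neg_div]

end Rings

/-! ### Determinantal representations and local equivalence -/

section Matrices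

variable {R : Type*} [CommRing R]
variable {m m' : Type*} [Fintype m] [DecidableEq m] [Fintype m'] [DecidableEq m']

/-- `M` is a determinantal representation of the hypersurface germ `{F = 0}`: it vanishes at the
origin and `det M` generates the same ideal as `F`. Here `ev` is the evaluation at the origin. -/
def IsDetRep {k : Type*} [Field k] (ev : R → k) (F : R) (M : Matrix m m R) : Prop :=
  (∀ i j, ev (M i j) = 0) ∧ Associated M.det F

/-- Local equivalence `N = A M B` with `A`, `B` invertible over the ring; the two index sets are
identified by some bijection. -/
def LocallyEquivalent (M : Matrix m m R) (N : Matrix m' m' R) : Prop :=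
  ∃ (e : m ≃ m') (A B : (Matrix m' m' R)ˣ), A.val * Matrix.reindex e e M * B.val = N

end Matrices

/-! ### Smoothness and tangency: the linear part at the origin -/

section Smooth

variable {k : Type*} [Field k] {n : ℕ}

/-- The hypersurface germ `{f = 0}` is smooth at the origin: `f(0) = 0` (`c` is the value at the
origin) and the linear part `ℓ` of `f` is not zero. -/
def IsSmoothWith (c : k) (ℓ : (Fin n → k) →ₗ[k] k) : Prop := c = 0 ∧ ℓ ≠ 0

/-- The smooth hypersurface germs with linear parts `ℓ`, `ℓ'` are non-tangent: their tangent
hyperplanes `{ℓ = 0}` and `{ℓ' = 0}` differ. -/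
def NonTangentWith (ℓ ℓ' : (Fin n → k) →ₗ[k] k) : Prop :=
  LinearMap.ker ℓ ≠ LinearMap.ker ℓ'

end Smooth

/-! ### Germs of functions -/

section Germs

variable {k : Type*} [NontriviallyNormedField k] {n : ℕ}

/-- The value of a germ at the origin. -/
def germValue (φ : FunGerm k n) : k := φ.value

/-- The linear part of a germ at the origin, i.e. its differential there. -/
def germLinearPart (φ : FunGerm k n) : (Fin n → k) →ₗ[k] k :=
  φ.liftOn (fun g => ((fderiv k g 0 : (Fin n → k) →L[k] k) : (Fin n → k) →ₗ[k] k))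
    (fun _ _ h => by simp only [h.fderiv_eq])

/-- The hypersurface germ defined by `φ` is smooth at the origin. -/
def GermSmooth (φ : FunGerm k n) : Prop := IsSmoothWith (germValue φ) (germLinearPart φ)

/-- The smooth hypersurface germs defined by `φ` and `ψ` are not tangent to each other. -/
def GermNonTangent (φ ψ : FunGerm k n) : Prop :=
  NonTangentWith (germLinearPart φ) (germLinearPart ψ)

/-- The order of vanishing of (the Taylor expansion of) `g` at the point `x`: the least `j` such
that the `j`-th derivative of `g` at `x` is not zero. -/
def vanishingOrder (g : (Fin n → k) → k) (x : Fin n → k) : ℕ∞ :=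
  ⨅ (j : ℕ) (_ : iteratedFDeriv k j g x ≠ 0), (j : ℕ∞)

/-- The corank of a square matrix over a field. -/
def corank {K m : Type*} [Field K] [Fintype m] [DecidableEq m] (M : Matrix m m K) : ℕ :=
  Fintype.card m - M.rank

/-- A matrix of germs is maximally generated near the origin: at all points `x` of some
neighbourhood of the origin its corank is the multiplicity of `{det = 0}` at `x`.
(The condition does not depend on the representative `F`.) -/
def GermMaxGenNear {m : Type*} [Fintype m] [DecidableEq m] (M : Matrix m m (FunGerm k n)) : Prop :=
  ∃ F : (Fin n → k) → Matrix m m k,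
    (∀ i j, M i j = ((fun x => F x i j : (Fin n → k) → k) : FunGerm k n)) ∧
    ∀ᶠ x in 𝓝 (0 : Fin n → k),
      (corank (F x) : ℕ∞) = vanishingOrder (fun y => (F y).det) x

end Germs

/-! ### Formal power series -/

section Formal

variable {k : Type*} [Field k] {n : ℕ}

/-- The linear part `∑ aᵢ xᵢ` of a formal power series. -/
def formalLinearPart (φ : MvPowerSeries (Fin n) k) : (Fin n → k) →ₗ[k] k :=
  ∑ i, MvPowerSeries.coeff (Finsupp.single i 1) φ • LinearMap.proj i

/-- The formal hypersurface germ defined by `φ` is smooth at the origin. -/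
def FormalSmooth (φ : MvPowerSeries (Fin n) k) : Prop :=
  IsSmoothWith (MvPowerSeries.constantCoeff φ) (formalLinearPart φ)

/-- The smooth formal hypersurface germs of `φ` and `ψ` are not tangent to each other. -/
def FormalNonTangent (φ ψ : MvPowerSeries (Fin n) k) : Prop :=
  NonTangentWith (formalLinearPart φ) (formalLinearPart ψ)

/-- The order of vanishing of `a` at the point `p` of `Spec R`: the order of `a` with respect to
the maximal ideal of the local ring `R_p`. -/
def primeOrder {R : Type*} [CommRing R] (p : Ideal R) [p.IsPrime] (a : R) : ℕ∞ :=
  ⨆ (j : ℕ) (_ : algebraMap R (Localization.AtPrime p) a ∈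
    IsLocalRing.maximalIdeal (Localization.AtPrime p) ^ j), (j : ℕ∞)

/-- A matrix over a local ring `R` is maximally generated on the germ `Spec R`: at all points `p`
of `Spec R` its corank (over the residue field of `p`) is the multiplicity of `{det = 0}` at `p`. -/
def SpecMaxGen {R : Type*} [CommRing R] {m : Type*} [Fintype m] [DecidableEq m]
    (M : Matrix m m R) : Prop :=
  ∀ (p : Ideal R) [p.IsPrime],
    (corank (M.map (algebraMap R p.ResidueField)) : ℕ∞) = primeOrder p M.det

end Formal

end DetRep

end

/-!
Let `R` be one of the three rings, `f₁, …, f_r` the smooth, pairwise non-tangent elements,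
`F = ∏ f_a`, `F_a = ∏_{b ≠ a} f_b`, and let `M` be a `d × d` matrix vanishing at the origin with
`det M ~ F` and corank equal to the multiplicity of `F` at all points.

**Multiplicity.** At each point the order of vanishing of `F` is the number of the components
through that point: a direction `v` that is transversal to all components at once makes every `f_a`
vanish to order exactly one along `v`, and this persists at all points near the origin. In the
formal case `v` acts on `R` as a derivation (`DetRep.primeOrder_prod`), in the case of germs one
restricts to lines (`DetRep.vanishingOrder_mul_prod`). Hence `diag(f₁, …, f_r)` is maximally
generated. At the origin one gets `d ≤ r`.

**The adjugate.** Since the tangent hyperplanes differ, `(f_a)` and `(f_a, f_b)` are prime for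
`a ≠ b`. On `X_a ∩ X_b` the matrix `M` has corank at least the number `c + 1` of the components that
contain `X_a ∩ X_b`. A minor of size `d - 1` has corank at least `c` there, so, modulo `f_a`, it is
divisible by the `c`-th power of the prime `f_b`. As this holds for all `b`, the adjugate of `M` has
entries in `(f_a, F_a)` (`Matrix.adjugate_mem_span_pair_prod_erase`).

**Diagonalization** (`DetRep.locallyEquivalent_diagonal`). Write `adj M = f_a G_a + F_a N_a`. Since
`adj M * M = det M` is divisible by `f_a`, so is `N_a M`, say `N_a M = f_a Q_a`. Moreover
`adj M ≡ ∑ F_a N_a` modulo `F`, and multiplication by `M` shows that `∑ Q_a` is a unit scalar matrix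
modulo the maximal ideal. Expanding `det (∑ Q_a)` by rows one finds a map `σ` such that the matrix
`W` whose `j`-th row is that of `Q_{σ j}` is invertible. If `B` is composed in the same way of the
rows of the `N_{σ j}`, then `B M = diag(f_{σ j}) W`. Comparison of determinants shows that `σ` is
onto, hence bijective because `d ≤ r`, and that `B` is invertible.

**Primes.** For formal power series, division with remainder by a smooth `f` identifies `R / (f)`
with a ring of power series in one variable less (`MvPowerSeries.exists_retraction_ker_eq_span`).
For convergent ones, there is an analytic retraction `ρ` onto the common zero set of the given
functions such that every `h - h ∘ ρ` lies in the ideal they generate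
(`AnalyticAt.exists_retraction`, by the inverse function theorem and Hadamard's lemma); so the ideal
is prime and consists of all the functions vanishing on the zero set, which translates the pointwise
condition on coranks into one at the prime `(f_a, f_b)`. For rational functions, ideals
are contracted from the analytic germs (`DetRep.mem_of_inclusion_mem_map`, by Taylor expansion
and Krull's intersection theorem), so that the statement on the adjugate descends.
-/

/-! ### Divisibility by a product of primes -/

/-- An element is divisible by a product of primes, with repetitions up to units, as soon as it is
divisible by the power of each of them that occurs in the product. The ring need not be a unique
factorization domain. -/
theorem Finset.prod_dvd_of_pow_card_dvd {A ι : Type*} [CommRing A] [IsDomain A]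
    (s : Finset ι) (h : ι → A) (hp : ∀ i ∈ s, Prime (h i)) (a : A)
    (H : ∀ i ∈ s, ∀ c : ℕ, (∃ t ⊆ s, t.card = c ∧ ∀ j ∈ t, h i ∣ h j) → h i ^ c ∣ a) :
    ∏ j ∈ s, h j ∣ a := by
  classical
  induction s using Finset.induction_on generalizing a with
  | empty => simp
  | insert b s hb ih =>
    have hpb : Prime (h b) := hp b (Finset.mem_insert_self _ _)
    obtain ⟨a', rfl⟩ : h b ∣ a := by
      simpa using H b (Finset.mem_insert_self _ _) 1 ⟨{b}, by simp, by simp, by simp⟩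
    rw [Finset.prod_insert hb]
    refine mul_dvd_mul_left _ (ih (fun i hi => hp i (Finset.mem_insert_of_mem hi)) a' ?_)
    rintro i hi c ⟨t, hts, htc, ht⟩
    have hpi : Prime (h i) := hp i (Finset.mem_insert_of_mem hi)
    by_cases hib : h i ∣ h b
    · have h1 : h i ^ (c + 1) ∣ h b * a' := by
        refine H i (Finset.mem_insert_of_mem hi) (c + 1)
          ⟨insert b t, Finset.insert_subset_insert _ hts, ?_, ?_⟩
        · rw [Finset.card_insert_of_notMem fun hbt => hb (hts hbt), htc]
        · simpa [hib] using ht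
      obtain ⟨u, hu⟩ := hpi.associated_of_dvd hpb hib
      rw [← hu, pow_succ', mul_assoc] at h1
      have h2 := (mul_dvd_mul_iff_left hpi.ne_zero).1 h1
      exact (Units.dvd_mul_left).1 h2
    · refine hpi.pow_dvd_of_dvd_mul_left _ hib ?_
      exact H i (Finset.mem_insert_of_mem hi) c ⟨t, hts.trans (Finset.subset_insert _ _), htc, ht⟩

/-! ### The rank of a matrix at a prime ideal -/

namespace Matrix

section Diagonalization

variable {m : Type*} [Fintype m]

theorem exists_mul_diagonal_mul [DecidableEq m] {K : Type*} [Field K] (N : Matrix m m K) :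
    ∃ (P Q : Matrix m m K) (D : m → K), IsUnit P ∧ IsUnit Q ∧ N = P * diagonal D * Q := by
  obtain ⟨L, L', D, h⟩ := Pivot.exists_list_transvec_mul_diagonal_mul_list_transvec N
  refine ⟨_, _, D, ?_, ?_, h⟩ <;>
  simp [isUnit_iff_isUnit_det, TransvectionStruct.det_toMatrix_prod]

variable {R : Type*} [CommRing R] (p : Ideal R) [p.IsPrime]

/-- A matrix over the residue field of `p` lifts to a matrix over the ring, up to a common
denominator. -/
theorem exists_map_eq_smul_residueField {m' : Type*} [Fintype m']
    (U : Matrix m m' p.ResidueField) :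
    ∃ (c : p.ResidueField) (V : Matrix m m' R), c ≠ 0 ∧
      V.map (algebraMap R p.ResidueField) = c • U := by
  classical
  obtain ⟨b, hb⟩ := IsLocalization.exist_integer_multiples_of_finite
    (nonZeroDivisors (R ⧸ p)) (fun ij : m × m' => U ij.1 ij.2)
  choose V hV using fun ij => hb ij
  choose W hW using fun ij => Ideal.Quotient.mk_surjective (I := p) (V ij)
  refine ⟨algebraMap (R ⧸ p) p.ResidueField b, Matrix.of fun i j => W (i, j), ?_, ?_⟩
  · simp
  · ext i j
    have := hV (i, j)
    rw [← hW] at this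
    rw [map_apply, of_apply, smul_apply, smul_eq_mul, ← Algebra.smul_def, ← this,
      IsScalarTower.algebraMap_apply R (R ⧸ p) p.ResidueField]
    rfl

/-- If `N` has corank at least `s` at `p`, then multiplication by a matrix that is invertible at `p`
brings `s` of the columns of `N` into `p`. -/
theorem exists_det_notMem_of_rank_add_le [DecidableEq m] (N : Matrix m m R) (s : ℕ)
    (hs : (N.map (algebraMap R p.ResidueField)).rank + s ≤ Fintype.card m) :
    ∃ U : Matrix m m R, U.det ∉ p ∧ ∃ T : Finset m, T.card = s ∧
      ∀ j ∈ T, ∀ i, (N * U) i j ∈ p := by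
  classical
  obtain ⟨P, Q, D, hP, hQ, h⟩ := exists_mul_diagonal_mul (N.map (algebraMap R p.ResidueField))
  obtain ⟨c, U, hc, hU⟩ := exists_map_eq_smul_residueField p Q⁻¹
  have hQd := (isUnit_iff_isUnit_det Q).1 hQ
  have hPd := (isUnit_iff_isUnit_det P).1 hP
  have hker : ∀ a : R, algebraMap R p.ResidueField a = 0 ↔ a ∈ p := fun a =>
    Ideal.algebraMap_residueField_eq_zero
  have hrank : Fintype.card {i // D i ≠ 0} = (N.map (algebraMap R p.ResidueField)).rank := by
    rw [h, rank_mul_eq_left_of_isUnit_det _ _ hQd, rank_mul_eq_right_of_isUnit_det _ _ hPd,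
      rank_diagonal]
  have hcard : s ≤ (Finset.univ.filter fun i => D i = 0).card := by
    have h1 := Finset.card_filter_add_card_filter_not (s := (Finset.univ : Finset m))
      (fun i => D i = 0)
    rw [Fintype.card_subtype] at hrank
    rw [Finset.card_univ] at h1
    simp only [ne_eq] at hrank
    omega
  obtain ⟨T, hT, hTs⟩ := Finset.exists_subset_card_eq hcard
  refine ⟨U, ?_, T, hTs, fun j hj i => ?_⟩
  · rw [← hker, RingHom.map_det, RingHom.mapMatrix_apply, hU, det_smul]
    simp only [mul_eq_zero, not_or]
    refine ⟨pow_ne_zero _ hc, ?_⟩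
    simpa using hQd
  · have hj : D j = 0 := (Finset.mem_filter.1 (hT hj)).2
    rw [← hker, ← map_apply (M := N * U) (f := algebraMap R p.ResidueField), Matrix.map_mul, hU, h,
      Matrix.mul_smul, Matrix.mul_assoc _ Q, mul_nonsing_inv _ hQd, Matrix.mul_one, smul_apply,
      mul_diagonal, hj]
    simp

/-- A bound for the rank at `p` that refers to the ring `R` only. Products `U * N * V` take the
place of minors, so that no choice of rows and columns is needed. -/
theorem rank_lt_of_forall_det_mem [DecidableEq m] (N : Matrix m m R) (t : ℕ)
    (h : ∀ (U : Matrix (Fin t) m R) (V : Matrix m (Fin t) R), (U * N * V).det ∈ p) :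
    (N.map (algebraMap R p.ResidueField)).rank < t := by
  classical
  by_contra! hlt
  obtain ⟨P, Q, D, hP, hQ, hN⟩ := exists_mul_diagonal_mul (N.map (algebraMap R p.ResidueField))
  have hQd := (isUnit_iff_isUnit_det Q).1 hQ
  have hPd := (isUnit_iff_isUnit_det P).1 hP
  rw [hN, rank_mul_eq_left_of_isUnit_det _ _ hQd, rank_mul_eq_right_of_isUnit_det _ _ hPd,
      rank_diagonal] at hlt
  obtain ⟨e⟩ : Nonempty (Fin t ↪ {i // D i ≠ 0}) :=
    Function.Embedding.nonempty_of_card_le (by simpa using hlt)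
  let g : Fin t → m := fun i => (e i).1
  have hg : Function.Injective g := fun a b hab => e.injective (Subtype.ext hab)
  obtain ⟨c, U, hc, hU⟩ := exists_map_eq_smul_residueField p (P⁻¹.submatrix g id)
  obtain ⟨c', V, hc', hV⟩ := exists_map_eq_smul_residueField p (Q⁻¹.submatrix id g)
  have key : (P⁻¹.submatrix g id) * (P * diagonal D * Q) * (Q⁻¹.submatrix id g)
      = diagonal (D ∘ g) := by
    have h1 : P⁻¹ * (P * diagonal D * Q) * Q⁻¹ = diagonal D := by
      rw [Matrix.mul_assoc, Matrix.mul_assoc _ Q, mul_nonsing_inv _ hQd, Matrix.mul_one,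
        ← Matrix.mul_assoc, nonsing_inv_mul _ hPd, Matrix.one_mul]
    have h2 := submatrix_diagonal D g hg
    rw [← h1] at h2
    rw [← h2]
    rfl
  have h2 := h U V
  rw [← Ideal.algebraMap_residueField_eq_zero, RingHom.map_det, RingHom.mapMatrix_apply,
    Matrix.map_mul, Matrix.map_mul, hU, hV, hN] at h2
  rw [Matrix.smul_mul, Matrix.mul_smul, Matrix.smul_mul, key, det_smul, det_smul,
    det_diagonal] at h2
  simp only [mul_eq_zero, pow_eq_zero_iff', hc, hc', false_and, false_or,
    Finset.prod_eq_zero_iff] at h2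
  obtain ⟨i, -, hi⟩ := h2
  exact (e i).2 hi

end Diagonalization

end Matrix

/-! ### The entries of the adjugate matrix -/

section Divisibility

variable {R : Type*} [CommRing R] {m : Type*} [Fintype m] [DecidableEq m]

theorem Ideal.mem_span_pair_iff_mk_dvd_mk {f h a : R} :
    a ∈ Ideal.span {f, h} ↔
      Ideal.Quotient.mk (Ideal.span {f}) h ∣ Ideal.Quotient.mk (Ideal.span {f}) a := by
  rw [Ideal.mem_span_pair]
  constructor
  · rintro ⟨x, y, rfl⟩
    refine ⟨Ideal.Quotient.mk _ y, ?_⟩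
    have : Ideal.Quotient.mk (Ideal.span {f}) f = 0 :=
      Ideal.Quotient.eq_zero_iff_mem.2 (Ideal.mem_span_singleton_self f)
    simp [this, mul_comm]
  · rintro ⟨y, hy⟩
    obtain ⟨y, rfl⟩ := Ideal.Quotient.mk_surjective y
    rw [← map_mul, Ideal.Quotient.eq, Ideal.mem_span_singleton'] at hy
    obtain ⟨x, hx⟩ := hy
    exact ⟨x, y, by rw [hx]; ring⟩

theorem Ideal.prime_mk_of_isPrime_span_pair {f h : R} (hp : (Ideal.span {f, h}).IsPrime)
    (hh : h ∉ Ideal.span {f}) : Prime (Ideal.Quotient.mk (Ideal.span {f}) h) := by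
  refine ⟨fun h0 => hh (Ideal.Quotient.eq_zero_iff_mem.1 h0), fun hu => ?_, fun a b hab => ?_⟩
  · refine hp.ne_top ((Ideal.eq_top_iff_one _).2 ?_)
    rw [Ideal.mem_span_pair_iff_mk_dvd_mk]
    exact hu.dvd
  · obtain ⟨a, rfl⟩ := Ideal.Quotient.mk_surjective a
    obtain ⟨b, rfl⟩ := Ideal.Quotient.mk_surjective b
    rw [← map_mul, ← Ideal.mem_span_pair_iff_mk_dvd_mk] at hab
    simpa only [Ideal.mem_span_pair_iff_mk_dvd_mk] using hp.mem_or_mem hab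

/-- If `N` has corank at least `s` at the prime ideal `(f, h)`, then `det N` is divisible by `h ^ s`
modulo `f`. -/
theorem Matrix.pow_dvd_mk_det {f h : R} (hf : (Ideal.span {f}).IsPrime)
    (p : Ideal R) [hp : p.IsPrime] (hpe : p = Ideal.span {f, h}) (hh : h ∉ Ideal.span {f})
    (N : Matrix m m R) (s : ℕ)
    (hs : (N.map (algebraMap R p.ResidueField)).rank + s ≤ Fintype.card m) :
    Ideal.Quotient.mk (Ideal.span {f}) h ^ s ∣ Ideal.Quotient.mk (Ideal.span {f}) N.det := by
  obtain ⟨U, hU, T, hT, hNU⟩ := exists_det_notMem_of_rank_add_le p N s hs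
  subst hpe
  set π := Ideal.Quotient.mk (Ideal.span {f})
  have hprime : Prime (π h) := Ideal.prime_mk_of_isPrime_span_pair hp hh
  simp only [Ideal.mem_span_pair_iff_mk_dvd_mk] at hU hNU
  choose! w hw using hNU
  -- The columns of `N * U` in `T` are divisible by `h`; `W` is what remains of `N * U`.
  let v : m → R ⧸ Ideal.span {f} := fun j => if j ∈ T then π h else 1
  let W : Matrix m m (R ⧸ Ideal.span {f}) :=
    Matrix.of fun i j => if j ∈ T then w j i else π ((N * U) i j)
  have h1 : (N * U).map π = Matrix.of fun i j => v j * W i j := by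
    ext i j
    by_cases hj : j ∈ T
    · simpa [v, W, hj] using hw j hj i
    · simp [v, W, hj]
  have h2 : π N.det * π U.det = π h ^ s * W.det := by
    rw [← map_mul, ← det_mul, RingHom.map_det, RingHom.mapMatrix_apply, h1, det_mul_row]
    simp [v, hT]
  exact hprime.pow_dvd_of_dvd_mul_right s hU (h2 ▸ dvd_mul_right _ _)

theorem Matrix.rank_updateRow_le {K : Type*} [Field K] (N : Matrix m m K) (i : m) (v : m → K) :
    (N.updateRow i v).rank ≤ N.rank + 1 := by
  have h : N.updateRow i v = N + vecMulVec (Pi.single i 1) (v - N i) := by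
    ext a b
    by_cases hab : a = i
    · subst hab; simp [vecMulVec_apply]
    · simp [vecMulVec_apply, hab]
  rw [h]
  refine le_trans ?_ (Nat.add_le_add_left (rank_vecMulVec_le (Pi.single i 1) (v - N i)) _)
  unfold Matrix.rank
  rw [mulVecLin_add]
  refine (Submodule.finrank_mono ?_).trans (Submodule.finrank_add_le_finrank_add_finrank _ _)
  rintro _ ⟨x, rfl⟩
  exact Submodule.add_mem_sup ⟨x, rfl⟩ ⟨x, rfl⟩

/-- If, at each of the prime ideals `(f a, f b)`, the corank of `M` is at least the number of the
`f c` in that ideal, then the adjugate of `M` vanishes modulo `f a` and the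
product of the others. -/
theorem Matrix.adjugate_mem_span_pair_prod_erase {ι : Type*} [Fintype ι] [DecidableEq ι]
    (f : ι → R) (a : ι) (hf : (Ideal.span {f a}).IsPrime)
    (hp : ∀ b ≠ a, (Ideal.span {f a, f b}).IsPrime) (hne : ∀ b ≠ a, f b ∉ Ideal.span {f a})
    (M : Matrix m m R)
    (hM : ∀ (p : Ideal R) [p.IsPrime], (∃ b ≠ a, p = Ideal.span {f a, f b}) →
      ∀ s : Finset ι, (∀ c ∈ s, f c ∈ p) →
      (M.map (algebraMap R p.ResidueField)).rank + s.card ≤ Fintype.card m) (i j : m) :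
    M.adjugate i j ∈ Ideal.span {f a, ∏ b ∈ Finset.univ.erase a, f b} := by
  rw [Ideal.mem_span_pair_iff_mk_dvd_mk, map_prod]
  refine Finset.prod_dvd_of_pow_card_dvd _ _ (fun b hb => ?_) _ fun b hb c ⟨t, ht, htc, htb⟩ => ?_
  · have hb := Finset.ne_of_mem_erase hb
    exact Ideal.prime_mk_of_isPrime_span_pair (hp b hb) (hne b hb)
  · have hb := Finset.ne_of_mem_erase hb
    have := hp b hb
    rw [adjugate_apply]
    refine pow_dvd_mk_det hf _ rfl (hne b hb) _ c ?_
    rw [map_updateRow]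
    refine (Nat.add_le_add_right (rank_updateRow_le _ _ _) _).trans ?_
    -- An entry of the adjugate is the determinant of `M` with one row replaced, which costs one in
    -- the corank; this is made up for by `f a`, which is not among the factors of the product.
    have hat : a ∉ t := fun h => Finset.notMem_erase a _ (ht h)
    have := hM (Ideal.span {f a, f b}) ⟨b, hb, rfl⟩ (insert a t) ?_
    · rw [Finset.card_insert_of_notMem hat, htc] at this
      omega
    · intro d hd
      rcases Finset.mem_insert.1 hd with rfl | hd
      · exact Ideal.subset_span (by simp)
      · rw [Ideal.mem_span_pair_iff_mk_dvd_mk]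
        exact htb d hd

end Divisibility

/-! ### Diagonalization of a determinantal representation -/

/-- A determinantal representation of `∏ f a`, of size at most the number of factors, is equivalent
to the diagonal one if its adjugate lies in all the ideals `(f a, ∏ b ≠ a, f b)`. The ring is local,
in the sense that all elements with nonzero value under `ev` are units. -/
theorem DetRep.locallyEquivalent_diagonal {R K : Type*} [CommRing R] [IsDomain R] [Field K]
    (ev : R →+* K) (hev : ∀ a, ev a ≠ 0 → IsUnit a) {r d : ℕ} (f : Fin r → R)
    (hf : ∀ a, Prime (f a)) (hndvd : ∀ a b, a ≠ b → ¬ f a ∣ f b)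
    (M : Matrix (Fin d) (Fin d) R) (hM : ∀ i j, ev (M i j) = 0)
    (hdet : Associated M.det (∏ a, f a)) (hdr : d ≤ r)
    (hadj : ∀ a i j, M.adjugate i j ∈ Ideal.span {f a, ∏ b ∈ Finset.univ.erase a, f b}) :
    DetRep.LocallyEquivalent M (Matrix.diagonal f) := by
  classical
  obtain ⟨u, hu⟩ := hdet.symm
  have hF : ∀ a, (∏ b, f b) = f a * ∏ b ∈ Finset.univ.erase a, f b := fun a =>
    (Finset.mul_prod_erase _ _ (Finset.mem_univ a)).symm
  have hF0 : (∏ b, f b) ≠ 0 := Finset.prod_ne_zero_iff.2 fun a _ => (hf a).ne_zero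
  have hndF : ∀ a, ¬ f a ∣ ∏ b ∈ Finset.univ.erase a, f b := fun a h => by
    obtain ⟨b, hb, hab⟩ := ((hf a).dvd_finsetProd_iff _).1 h
    exact hndvd a b (Finset.ne_of_mem_erase hb).symm hab
  simp only [Ideal.mem_span_pair] at hadj
  choose G N hGN using hadj
  let N' : Fin r → Matrix (Fin d) (Fin d) R := fun a => Matrix.of (N a)
  let G' : Fin r → Matrix (Fin d) (Fin d) R := fun a => Matrix.of (G a)
  have hGN' : ∀ a, M.adjugate = f a • G' a + (∏ b ∈ Finset.univ.erase a, f b) • N' a := by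
    intro a; ext i j
    simp [G', N', ← hGN a i j, mul_comm]
  -- `N' a * M` is divisible by `f a`, since `f a` is prime and does not divide the other factor.
  have hQ : ∀ a i j, f a ∣ (N' a * M) i j := by
    intro a i j
    have h1 : (M.adjugate * M) i j = f a * (G' a * M) i j +
        (∏ b ∈ Finset.univ.erase a, f b) * (N' a * M) i j := by
      rw [hGN' a]; simp [Matrix.add_mul]
    have h2 : f a ∣ (∏ b ∈ Finset.univ.erase a, f b) * (N' a * M) i j := by
      rw [← dvd_add_right (dvd_mul_right (f a) _), ← h1, Matrix.adjugate_mul, ← hu, hF a]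
      simp only [Matrix.smul_apply, smul_eq_mul, mul_assoc]
      exact dvd_mul_right _ _
    exact ((hf a).dvd_or_dvd h2).resolve_left (hndF a)
  choose Q hQ using hQ
  let Q' : Fin r → Matrix (Fin d) (Fin d) R := fun a => Matrix.of (Q a)
  have hQ' : ∀ a, N' a * M = f a • Q' a := fun a => by ext i j; simp [Q', ← hQ a i j]
  -- The difference is divisible by each `f a`, and the `f a` are pairwise non-associated primes.
  have hH : ∀ i j, (∏ b, f b) ∣
      (M.adjugate - ∑ a, (∏ b ∈ Finset.univ.erase a, f b) • N' a) i j := by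
    intro i j
    refine Finset.prod_dvd_of_pow_card_dvd _ _ (fun a _ => hf a) _ ?_
    rintro a - c ⟨t, -, htc, ht⟩
    have hta : t ⊆ {a} := fun b hb => by
      by_contra hba
      exact hndvd a b (fun h => hba (by simp [h])) (ht b hb)
    have hc : c ≤ 1 := by rw [← htc]; simpa using Finset.card_le_card hta
    refine (pow_dvd_pow _ hc).trans ?_
    rw [pow_one, ← Finset.add_sum_erase _ _ (Finset.mem_univ a), hGN' a]
    have : (f a • G' a + (∏ b ∈ Finset.univ.erase a, f b) • N' a -
        ((∏ b ∈ Finset.univ.erase a, f b) • N' a +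
          ∑ x ∈ Finset.univ.erase a, (∏ b ∈ Finset.univ.erase x, f b) • N' x)) i j =
        f a * G' a i j -
          ∑ x ∈ Finset.univ.erase a, (∏ b ∈ Finset.univ.erase x, f b) * N' x i j := by
      simp [Matrix.sum_apply, -Finset.sum_erase_eq_sub]
      ring
    rw [this]
    refine dvd_sub (dvd_mul_right _ _) (Finset.dvd_sum fun x hx => Dvd.dvd.mul_right ?_ _)
    exact Finset.dvd_prod_of_mem _ (by simpa using (Finset.ne_of_mem_erase hx).symm)
  choose H hH using hH
  let H' : Matrix (Fin d) (Fin d) R := Matrix.of H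
  have hH' : M.adjugate = ∑ a, (∏ b ∈ Finset.univ.erase a, f b) • N' a + (∏ b, f b) • H' := by
    rw [← sub_eq_iff_eq_add']
    ext i j
    rw [hH i j]; simp [H']
  have hsum : (u : R) • (1 : Matrix (Fin d) (Fin d) R) = ∑ a, Q' a + H' * M := by
    have h1 := Matrix.adjugate_mul M
    rw [← hu, hH', Matrix.add_mul, Matrix.sum_mul] at h1
    have h2 : ∀ a, ((∏ b ∈ Finset.univ.erase a, f b) • N' a) * M = (∏ b, f b) • Q' a := by
      intro a
      rw [Matrix.smul_mul, hQ' a, smul_smul, mul_comm, ← hF a]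
    simp only [h2, Matrix.smul_mul, ← Finset.smul_sum, ← smul_add] at h1
    rw [mul_smul] at h1
    exact (smul_right_injective _ hF0 h1).symm
  -- Modulo the maximal ideal the sum of the `Q' a` is an invertible scalar matrix.
  have hdet0 : ev (∑ a, Q' a).det ≠ 0 := by
    have h1 : (∑ a, Q' a).map ev = (ev u) • (1 : Matrix (Fin d) (Fin d) K) := by
      have h2 : (H' * M).map ev = 0 := by
        ext i j
        simp [Matrix.mul_apply, hM]
      have h3 : ((u : R) • (1 : Matrix (Fin d) (Fin d) R)).map ev =
        (∑ a, Q' a + H' * M).map ev := by rw [hsum]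
      rw [Matrix.map_add ev (map_add ev), h2, add_zero] at h3
      rw [← h3]
      ext i j
      simp [Matrix.one_apply, apply_ite ev]
    rw [RingHom.map_det, RingHom.mapMatrix_apply, h1, Matrix.det_smul, Matrix.det_one, mul_one]
    exact pow_ne_zero _ (u.isUnit.map ev).ne_zero
  -- Multilinearity of the determinant in the rows.
  have hexp : (∑ a, Q' a).det = ∑ σ : Fin d → Fin r,
      (Matrix.of fun j => Q' (σ j) j : Matrix (Fin d) (Fin d) R).det := by
    have := (Matrix.detRowAlternating (n := Fin d) (R := R)).toMultilinearMap.map_sum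
      (fun (j : Fin d) (a : Fin r) => Q' a j)
    refine Eq.trans ?_ this
    change Matrix.det _ = Matrix.det _
    congr 1
    ext i j
    simp [Matrix.sum_apply]
  rw [hexp, map_sum] at hdet0
  obtain ⟨σ, -, hσ⟩ := Finset.exists_ne_zero_of_sum_ne_zero hdet0
  let W : Matrix (Fin d) (Fin d) R := Matrix.of fun j => Q' (σ j) j
  let B : Matrix (Fin d) (Fin d) R := Matrix.of fun j => N' (σ j) j
  have hW : IsUnit W.det := hev _ hσ
  have hBM : B * M = Matrix.diagonal (f ∘ σ) * W := by
    ext i j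
    have := congrFun (congrFun (hQ' (σ i)) i) j
    rw [Matrix.diagonal_mul]
    simpa [B, W, Matrix.mul_apply] using this
  have hBdet : B.det * ((∏ b, f b) * u) = (∏ j, f (σ j)) * W.det := by
    rw [hu, ← Matrix.det_mul, hBM, Matrix.det_mul, Matrix.det_diagonal]; rfl
  -- Each `f a` divides `det M`, hence the product of the `f (σ j)`.
  have hsurj : Function.Surjective σ := by
    intro a
    have h1 : f a ∣ (∏ j, f (σ j)) := by
      rw [← hW.dvd_mul_right, ← hBdet, hF a]
      exact ⟨B.det * ((∏ b ∈ Finset.univ.erase a, f b) * u), by ring⟩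
    obtain ⟨j, -, hj⟩ := ((hf a).dvd_finsetProd_iff _).1 h1
    exact ⟨j, by_contra fun h => hndvd a (σ j) (Ne.symm h) hj⟩
  have hcard : Fintype.card (Fin d) = Fintype.card (Fin r) :=
    le_antisymm (by simpa using hdr) (Fintype.card_le_of_surjective σ hsurj)
  let e : Fin d ≃ Fin r := Equiv.ofBijective σ
    ((Fintype.bijective_iff_surjective_and_card σ).2 ⟨hsurj, hcard⟩)
  have hB : IsUnit B.det := by
    have h1 : (∏ j, f (σ j)) = ∏ b, f b := e.prod_comp f
    rw [h1, mul_comm B.det, mul_assoc] at hBdet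
    have := mul_left_cancel₀ hF0 hBdet
    exact isUnit_of_mul_isUnit_right (this ▸ hW)
  have hWu := (Matrix.isUnit_iff_isUnit_det W).2 hW
  have hBu := (Matrix.isUnit_iff_isUnit_det B).2 hB
  let re := Matrix.reindexRingEquiv R e
  refine ⟨e, Units.map re.toMonoidHom hBu.unit, Units.map re.toMonoidHom hWu.unit⁻¹, ?_⟩
  change re B * re M * re ((hWu.unit⁻¹ : (Matrix (Fin d) (Fin d) R)ˣ) : Matrix _ _ R) = _
  have h1 : B * M * ((hWu.unit⁻¹ : (Matrix (Fin d) (Fin d) R)ˣ) : Matrix _ _ R) =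
      Matrix.diagonal (f ∘ σ) := by
    rw [Units.mul_inv_eq_iff_eq_mul]; exact hBM
  rw [← map_mul, ← map_mul, h1]
  ext i j
  obtain ⟨i, rfl⟩ := e.surjective i
  obtain ⟨j, rfl⟩ := e.surjective j
  by_cases hij : i = j
  · simp [re, e, hij]
  · have : σ i ≠ σ j := e.injective.ne hij
    simp [re, e, hij, this]

/-! ### Orders at prime ideals by means of derivations -/

section PrimeOrder

variable {A R : Type*} [CommRing A] [CommRing R] [Algebra A R] (D : Derivation A R R) {p : Ideal R}

theorem Derivation.apply_mem_pow {j : ℕ} {a : R} (ha : a ∈ p ^ (j + 1)) : D a ∈ p ^ j := by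
  induction j generalizing a with
  | zero => simp
  | succ j ih =>
    rw [pow_succ'] at ha
    refine Submodule.mul_induction_on ha (fun x hx y hy => ?_) fun x y hx hy => ?_
    · rw [D.leibniz, smul_eq_mul, smul_eq_mul]
      refine add_mem ?_ (Ideal.mul_mem_right _ _ hy)
      rw [pow_succ']
      exact Ideal.mul_mem_mul hx (ih hy)
    · rw [map_add]; exact add_mem hx hy

theorem Derivation.iterate_apply_mem {s : ℕ} {a : R} (ha : a ∈ p ^ (s + 1)) : D^[s] a ∈ p := by
  induction s generalizing a with
  | zero => simpa using ha
  | succ s ih => exact ih (D.apply_mem_pow ha)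

theorem Derivation.iterate_mul_sub_mem {s : ℕ} {a : R} (ha : a ∈ p ^ s) (c : R) :
    D^[s] (a * c) - c * D^[s] a ∈ p := by
  induction s generalizing a c with
  | zero => simp [mul_comm]
  | succ s ih =>
    rw [Function.iterate_succ_apply, Function.iterate_succ_apply, D.leibniz, iterate_map_add,
      smul_eq_mul, smul_eq_mul, mul_comm c (D a), add_sub_assoc]
    exact add_mem (D.iterate_apply_mem (Ideal.mul_mem_right _ _ ha)) (ih (D.apply_mem_pow ha) c)

theorem Derivation.iterate_succ_mul_sub_mem {s : ℕ} {a b : R} (ha : a ∈ p ^ s) (hb : b ∈ p) :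
    D^[s + 1] (a * b) - (s + 1) * D b * D^[s] a ∈ p := by
  induction s generalizing a with
  | zero =>
    have : D^[0 + 1] (a * b) - ((0 : ℕ) + 1) * D b * D^[0] a = b * D a := by
      simp [D.leibniz]; ring
    rw [this]
    exact Ideal.mul_mem_right _ _ hb
  | succ s ih =>
    have h1 := D.iterate_mul_sub_mem ha (D b)
    have h2 := ih (D.apply_mem_pow ha)
    rw [Function.iterate_succ_apply, D.leibniz, iterate_map_add, smul_eq_mul, smul_eq_mul,
      mul_comm b]
    convert add_mem h1 h2 using 1
    rw [← Function.iterate_succ_apply D s a]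
    push_cast
    ring

/-- The product of `s` elements of `p` has, modulo `p`, the `s`-th derivative `s!` times the product
of their derivatives; a further factor `t` is not differentiated. -/
theorem Derivation.iterate_mul_prod_sub_mem {ι : Type*} (f : ι → R) (t : R) (S : Finset ι)
    (hS : ∀ i ∈ S, f i ∈ p) :
    t * ∏ i ∈ S, f i ∈ p ^ S.card ∧
    D^[S.card] (t * ∏ i ∈ S, f i) - (S.card.factorial : R) * t * ∏ i ∈ S, D (f i) ∈ p := by
  classical
  induction S using Finset.induction_on with
  | empty => simp
  | insert b S hb ih =>
    obtain ⟨h1, h2⟩ := ih fun i hi => hS i (Finset.mem_insert_of_mem hi)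
    have hbp := hS b (Finset.mem_insert_self _ _)
    rw [Finset.card_insert_of_notMem hb, Finset.prod_insert hb, Finset.prod_insert hb,
      mul_comm (f b), ← mul_assoc]
    refine ⟨Ideal.mul_mem_mul h1 hbp, ?_⟩
    convert add_mem (D.iterate_succ_mul_sub_mem h1 hbp)
      (p.mul_mem_left ((S.card + 1) * D (f b)) h2) using 1
    rw [Nat.factorial_succ]
    push_cast
    ring

/-- The order at `p` of a product of elements, those of them in `p` having derivatives outside `p`,
is the number of factors in `p`: applied that many times, the derivation takes the product out of
`p`, by `Derivation.iterate_mul_prod_sub_mem`. -/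
theorem DetRep.primeOrder_prod {ι : Type*} (p : Ideal R) [p.IsPrime]
    (hp : ∀ n : ℕ, n ≠ 0 → (n : R) ∉ p) (f : ι → R) (T : Finset ι)
    (S : Finset ι) (hS : ∀ i, i ∈ S ↔ i ∈ T ∧ f i ∈ p)
    (hD : ∀ i ∈ S, D (f i) ∉ p) : DetRep.primeOrder p (∏ i ∈ T, f i) = S.card := by
  classical
  have hST : S ⊆ T := fun i hi => ((hS i).1 hi).1
  have hprod : ∏ i ∈ T, f i = (∏ i ∈ T \ S, f i) * ∏ i ∈ S, f i := (Finset.prod_sdiff hST).symm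
  have hmax : ∀ j : ℕ, IsLocalRing.maximalIdeal (Localization.AtPrime p) ^ j =
      Ideal.map (algebraMap R (Localization.AtPrime p)) (p ^ j) := fun j => by
    rw [Ideal.map_pow, Localization.AtPrime.map_eq_maximalIdeal]
  apply le_antisymm
  · refine iSup₂_le fun j hj => ?_
    by_contra! hlt
    rw [hmax, IsLocalization.algebraMap_mem_map_algebraMap_iff p.primeCompl] at hj
    obtain ⟨t, ht, htj⟩ := hj
    have hlt' : S.card < j := by exact_mod_cast hlt
    have h1 := D.iterate_apply_mem (Ideal.pow_le_pow_right (Nat.succ_le_of_lt hlt') htj)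
    rw [hprod, ← mul_assoc] at h1
    have h2 := (D.iterate_mul_prod_sub_mem f (t * ∏ i ∈ T \ S, f i) S
      fun i hi => ((hS i).1 hi).2).2
    rw [Submodule.sub_mem_iff_right _ h1] at h2
    have hP : p.IsPrime := inferInstance
    rcases hP.mem_or_mem h2 with h3 | h3
    · rcases hP.mem_or_mem h3 with h4 | h4
      · exact hp _ (Nat.factorial_ne_zero _) h4
      · rcases hP.mem_or_mem h4 with h5 | h5
        · exact ht h5
        · obtain ⟨i, hi, hip⟩ := hP.prod_mem_iff.1 h5
          rw [Finset.mem_sdiff] at hi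
          exact hi.2 ((hS i).2 ⟨hi.1, hip⟩)
    · obtain ⟨i, hi, hip⟩ := hP.prod_mem_iff.1 h3
      exact hD i hi hip
  · refine le_iSup₂_of_le S.card ?_ le_rfl
    rw [hmax]
    refine Ideal.mem_map_of_mem _ ?_
    rw [hprod]
    exact (D.iterate_mul_prod_sub_mem f _ S fun i hi => ((hS i).1 hi).2).1

theorem DetRep.primeOrder_eq_of_associated (p : Ideal R) [p.IsPrime] {a b : R}
    (h : Associated a b) : DetRep.primeOrder p a = DetRep.primeOrder p b := by
  obtain ⟨u, rfl⟩ := h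
  have : ∀ I : Ideal (Localization.AtPrime p), algebraMap R (Localization.AtPrime p) (a * u) ∈ I ↔
      algebraMap R (Localization.AtPrime p) a ∈ I := fun I => by
    rw [map_mul]
    exact Ideal.mul_unit_mem_iff_mem _ (u.isUnit.map _)
  simp only [DetRep.primeOrder, this]

end PrimeOrder

namespace DetRep

/-- The kernel of `ℓ` is the whole space or a maximal subspace, so it is not properly contained in
the kernel of a nonzero form. -/
theorem exists_mem_ker_ne_zero {k V : Type*} [Field k] [AddCommGroup V] [Module k V]
    {ℓ ℓ' : V →ₗ[k] k} (h' : ℓ' ≠ 0) (hne : LinearMap.ker ℓ ≠ LinearMap.ker ℓ') :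
    ∃ v, ℓ v = 0 ∧ ℓ' v ≠ 0 := by
  by_contra! hle
  refine hne (le_antisymm hle fun x hx => ?_)
  by_contra hfx
  refine h' (LinearMap.ext fun y => ?_)
  have hx : ℓ' x = 0 := hx
  have hfx : ℓ x ≠ 0 := hfx
  have := hle (y - (ℓ y / ℓ x) • x) (by simp [hfx])
  simpa [hx] using this

end DetRep

/-! ### Division of formal power series by a smooth one -/

namespace MvPowerSeries

variable {k : Type*} [Field k] {σ : Type*}

/-- The weighted degree of monomials in which `x i` has degree one and the other variables have
degree two. If `f` has no constant term and contains the monomial `x i`, then `x i` is the only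
monomial of least weight in `f`. -/
noncomputable def divWeight (i : σ) : (σ →₀ ℕ) →+ ℕ := by
  classical
  exact Finsupp.weight (fun j => if j = i then 1 else 2)

theorem divWeight_single_self (i : σ) : divWeight i (Finsupp.single i 1) = 1 := by
  simp [divWeight, Finsupp.weight_single]

theorem two_le_divWeight {i : σ} {a : σ →₀ ℕ} (h0 : a ≠ 0) (hi : a ≠ Finsupp.single i 1) :
    2 ≤ divWeight i a := by
  classical
  obtain ⟨j, hj⟩ : ∃ j, a j ≠ 0 := by
    by_contra! h; exact h0 (Finsupp.ext h)
  have ha : a = Finsupp.single j 1 + (a - Finsupp.single j 1) := by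
    ext l
    by_cases hl : j = l
    · subst hl; simp; omega
    · simp [hl]
  rw [ha, map_add]
  by_cases hji : j = i
  · subst hji
    have hb : a - Finsupp.single j 1 ≠ 0 := fun hb => by rw [hb, add_zero] at ha; exact hi ha
    obtain ⟨l, hl⟩ : ∃ l, (a - Finsupp.single j 1 : σ →₀ ℕ) l ≠ 0 := by
      by_contra! h; exact hb (Finsupp.ext h)
    have := Finsupp.le_weight (fun i => if i = j then 1 else 2) (s := l) (by split_ifs <;> simp)
      (a - Finsupp.single j 1)
    rw [divWeight_single_self]
    change _ ≤ divWeight j _ at this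
    omega
  · have : divWeight i (Finsupp.single j 1) = 2 := by
      simp [divWeight, Finsupp.weight_single, hji]
    omega

/-- The coefficient of `f * q` at `μ + eᵢ` determines that of `q` at `μ` by recursion on the
weight. -/
theorem coeff_add_single_mul [DecidableEq σ] {i : σ} {f : MvPowerSeries σ k}
    (h0 : constantCoeff f = 0)
    (q : MvPowerSeries σ k) (μ : σ →₀ ℕ) :
    coeff (μ + Finsupp.single i 1) (f * q) = coeff (Finsupp.single i 1) f * coeff μ q +
      ∑ ab ∈ Finset.HasAntidiagonal.antidiagonal (μ + Finsupp.single i 1),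
        if divWeight i ab.2 < divWeight i μ then coeff ab.1 f * coeff ab.2 q else 0 := by
  rw [coeff_mul, ← Finset.add_sum_erase _ _ (show (Finsupp.single i 1, μ) ∈ _ by
    simp [add_comm]),
    ← Finset.add_sum_erase (s := Finset.HasAntidiagonal.antidiagonal (μ + Finsupp.single i 1))
      (f := fun ab => if divWeight i ab.2 < divWeight i μ then coeff ab.1 f * coeff ab.2 q else 0)
      (show (Finsupp.single i 1, μ) ∈ _ by simp [add_comm])]
  simp only [lt_irrefl, if_false, zero_add]
  congr 1
  refine Finset.sum_congr rfl fun ab hab => ?_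
  obtain ⟨hne, hab⟩ := Finset.mem_erase.1 hab
  rw [Finset.HasAntidiagonal.mem_antidiagonal] at hab
  split_ifs with hlt
  · rfl
  · by_cases ha0 : ab.1 = 0
    · rw [ha0, coeff_zero_eq_constantCoeff_apply, h0, zero_mul]
    · exfalso
      have h1 : ab.1 ≠ Finsupp.single i 1 := fun h => by
        rw [h, add_comm] at hab
        exact hne (Prod.ext h (add_right_cancel hab))
      have h2 := two_le_divWeight ha0 h1
      have h3 := congrArg (divWeight i) hab
      rw [map_add, map_add, divWeight_single_self] at h3
      omega

/-- The coefficients of the quotient in the division of `h` by `f`, the remainder of which does not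
involve `x i`; see `exists_coeff_sub_mul_eq_zero`. They are defined by recursion on the weight. -/
noncomputable def divCoeff [DecidableEq σ] (i : σ) (f h : MvPowerSeries σ k) : (σ →₀ ℕ) → k :=
  (measure (divWeight i)).wf.fix fun μ rec =>
    (coeff (Finsupp.single i 1) f)⁻¹ * (coeff (μ + Finsupp.single i 1) h -
      ∑ ab ∈ Finset.HasAntidiagonal.antidiagonal (μ + Finsupp.single i 1),
        if hlt : divWeight i ab.2 < divWeight i μ then coeff ab.1 f * rec ab.2 hlt else 0)

/-- Division of `h` by `f`, with a remainder that does not involve `x i`. -/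
theorem exists_coeff_sub_mul_eq_zero {i : σ} {f : MvPowerSeries σ k}
    (h0 : constantCoeff f = 0) (hi : coeff (Finsupp.single i 1) f ≠ 0) (h : MvPowerSeries σ k) :
    ∃ q : MvPowerSeries σ k, ∀ ν : σ →₀ ℕ, ν i ≠ 0 → coeff ν (h - f * q) = 0 := by
  classical
  let q : MvPowerSeries σ k := fun μ => divCoeff i f h μ
  have hq : ∀ μ, coeff μ q = divCoeff i f h μ := fun μ => rfl
  refine ⟨q, fun ν hν => ?_⟩
  obtain ⟨μ, rfl⟩ : ∃ μ, ν = μ + Finsupp.single i 1 := by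
    refine ⟨ν - Finsupp.single i 1, ?_⟩
    ext l
    by_cases hl : i = l
    · subst hl; simp; omega
    · simp [hl]
  rw [map_sub, coeff_add_single_mul h0, hq μ, divCoeff, WellFounded.fix_eq, mul_inv_cancel_left₀ hi]
  simp only [dite_eq_ite, hq, divCoeff]
  ring

/-- Uniqueness of the division by `f`. -/
theorem eq_zero_of_coeff_mul_eq_zero {i : σ} {f q : MvPowerSeries σ k}
    (h0 : constantCoeff f = 0) (hi : coeff (Finsupp.single i 1) f ≠ 0)
    (h : ∀ ν : σ →₀ ℕ, ν i ≠ 0 → coeff ν (f * q) = 0) : q = 0 := by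
  classical
  ext μ
  induction hw : divWeight i μ using Nat.strong_induction_on generalizing μ with
  | _ w ih =>
    subst hw
    have h1 := h (μ + Finsupp.single i 1) (by simp)
    rw [coeff_add_single_mul h0, Finset.sum_eq_zero, add_zero] at h1
    · simpa [hi] using h1
    · intro ab _
      split_ifs with hlt
      · rw [ih _ hlt _ rfl]; simp
      · rfl

/-- The embedding of the power series that do not involve `x i`. -/
noncomputable abbrev inclCompl (k : Type*) [Field k] {σ : Type*} (i : σ) :
    MvPowerSeries {j : σ // j ≠ i} k →ₐ[k] MvPowerSeries σ k :=
  rename (Function.Embedding.subtype fun j : σ => j ≠ i)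

theorem coeff_inclCompl_eq_zero {i : σ} (r : MvPowerSeries {j : σ // j ≠ i} k) {ν : σ →₀ ℕ}
    (hν : ν i ≠ 0) : coeff ν (inclCompl k i r) = 0 := by
  refine coeff_rename_eq_zero _ _ ?_
  rintro ⟨x, rfl⟩
  refine hν (Finsupp.mapDomain_of_notMem_range _ _ ?_)
  rintro ⟨j, hj⟩
  exact j.2 hj

theorem exists_inclCompl_eq {i : σ} {h : MvPowerSeries σ k}
    (hh : ∀ ν : σ →₀ ℕ, ν i ≠ 0 → coeff ν h = 0) : ∃ r, inclCompl k i r = h := by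
  classical
  let e := Function.Embedding.subtype fun j : σ => j ≠ i
  let r : MvPowerSeries {j : σ // j ≠ i} k := fun x => coeff (Finsupp.embDomain e x) h
  refine ⟨r, ?_⟩
  ext ν
  by_cases hν : ν i = 0
  · obtain ⟨x, rfl⟩ : ∃ x, ν = Finsupp.embDomain e x := by
      refine ⟨Finsupp.comapDomain e ν e.injective.injOn, ?_⟩
      rw [Finsupp.embDomain_comapDomain]
      intro j hj
      exact ⟨⟨j, fun h => by subst h; simp [hν] at hj⟩, rfl⟩
    exact coeff_embDomain_rename e r x
  · rw [coeff_inclCompl_eq_zero _ hν, hh ν hν]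

/-- If `f` has no constant term and contains the monomial `x i`, then the quotient by `f` is the
ring of power series in the other variables. -/
theorem exists_retraction_ker_eq_span {i : σ} {f : MvPowerSeries σ k}
    (h0 : constantCoeff f = 0) (hi : coeff (Finsupp.single i 1) f ≠ 0) :
    ∃ π : MvPowerSeries σ k →+* MvPowerSeries {j : σ // j ≠ i} k,
      RingHom.ker π = Ideal.span {f} ∧ ∀ r, π (inclCompl k i r) = r := by
  let φ : MvPowerSeries {j : σ // j ≠ i} k →+* MvPowerSeries σ k ⧸ Ideal.span {f} :=
    (Ideal.Quotient.mk _).comp (inclCompl k i).toRingHom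
  have hφ : Function.Bijective φ := by
    constructor
    · rw [injective_iff_map_eq_zero]
      intro r hr
      obtain ⟨q, hq⟩ := Ideal.mem_span_singleton'.1 (Ideal.Quotient.eq_zero_iff_mem.1 hr)
      have hq : inclCompl k i r = f * q := by rw [mul_comm, hq]; rfl
      have hq0 : q = 0 := eq_zero_of_coeff_mul_eq_zero h0 hi fun ν hν => by
        rw [← hq, coeff_inclCompl_eq_zero r hν]
      rw [hq0, mul_zero] at hq
      ext x
      rw [← coeff_embDomain_rename (Function.Embedding.subtype fun j : σ => j ≠ i) r x]
      change coeff _ (inclCompl k i r) = _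
      rw [hq]; simp
    · intro y
      obtain ⟨h, rfl⟩ := Ideal.Quotient.mk_surjective y
      obtain ⟨q, hq⟩ := exists_coeff_sub_mul_eq_zero h0 hi h
      obtain ⟨r, hr⟩ := exists_inclCompl_eq hq
      refine ⟨r, ?_⟩
      change Ideal.Quotient.mk _ (inclCompl k i r) = _
      rw [hr, Ideal.Quotient.eq, Ideal.mem_span_singleton']
      exact ⟨-q, by ring⟩
  let e := RingEquiv.ofBijective φ hφ
  refine ⟨e.symm.toRingHom.comp (Ideal.Quotient.mk _), ?_, fun r => ?_⟩
  · ext h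
    simp [RingHom.mem_ker, Ideal.Quotient.eq_zero_iff_mem]
  · exact e.symm_apply_apply r

end MvPowerSeries

/-! ### Primes generated by smooth formal power series -/

namespace MvPowerSeries

variable {k : Type*} [Field k] {σ : Type*}

theorem isPrime_span_singleton {f : MvPowerSeries σ k} (h0 : constantCoeff f = 0)
    (hf : ∃ i, coeff (Finsupp.single i 1) f ≠ 0) : (Ideal.span {f}).IsPrime := by
  obtain ⟨i, hi⟩ := hf
  obtain ⟨π, hπ, -⟩ := exists_retraction_ker_eq_span h0 hi
  rw [← hπ]
  have : IsDomain (MvPowerSeries {j // j ≠ i} k) := NoZeroDivisors.to_isDomain _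
  exact RingHom.ker_isPrime π

/-- The derivative in the direction of a vector `v` with entries in `k`. -/
noncomputable def directionalDerivation [Fintype σ] (v : σ → k) :
    Derivation k (MvPowerSeries σ k) (MvPowerSeries σ k) :=
  ∑ j, v j • pderiv k j

theorem constantCoeff_directionalDerivation [Fintype σ] (v : σ → k) (f : MvPowerSeries σ k) :
    constantCoeff (directionalDerivation v f) = ∑ j, v j * coeff (Finsupp.single j 1) f := by
  have h : directionalDerivation v f = ∑ j, v j • pderiv k j f := by
    have := congrFun (map_sum (Derivation.coeFnAddMonoidHom (R := k) (A := MvPowerSeries σ k)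
      (M := MvPowerSeries σ k)) (fun j => v j • pderiv k j) Finset.univ) f
    exact this.trans (Finset.sum_apply _ _ _)
  rw [h, map_sum]
  refine Finset.sum_congr rfl fun j _ => ?_
  rw [constantCoeff_smul, smul_eq_mul, ← coeff_zero_eq_constantCoeff_apply, coeff_pderiv]
  simp

theorem constantCoeff_directionalDerivation_mul [Fintype σ] (v : σ → k) {f : MvPowerSeries σ k}
    (h0 : constantCoeff f = 0) (hv : constantCoeff (directionalDerivation v f) = 0)
    (g : MvPowerSeries σ k) : constantCoeff (directionalDerivation v (g * f)) = 0 := by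
  simp [h0, hv]

theorem notMem_span_singleton [Fintype σ] {f g : MvPowerSeries σ k} (h0 : constantCoeff f = 0)
    {v : σ → k} (hv : constantCoeff (directionalDerivation v f) = 0)
    (hv' : constantCoeff (directionalDerivation v g) ≠ 0) : g ∉ Ideal.span {f} := by
  intro hg
  obtain ⟨q, rfl⟩ := Ideal.mem_span_singleton'.1 hg
  exact hv' (constantCoeff_directionalDerivation_mul v h0 hv q)

/-- Smooth `f` and `g` whose linear parts are independent (as `v` shows) generate a prime ideal: the
restriction of `g` to `{f = 0}` is smooth. -/
theorem isPrime_span_pair [Fintype σ] {f g : MvPowerSeries σ k} (h0 : constantCoeff f = 0)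
    (hf : ∃ i, coeff (Finsupp.single i 1) f ≠ 0) (hg0 : constantCoeff g = 0)
    {v : σ → k} (hv : constantCoeff (directionalDerivation v f) = 0)
    (hv' : constantCoeff (directionalDerivation v g) ≠ 0) : (Ideal.span {f, g}).IsPrime := by
  classical
  obtain ⟨i, hi⟩ := hf
  obtain ⟨π, hπ, hret⟩ := exists_retraction_ker_eq_span h0 hi
  obtain ⟨q, hq⟩ : ∃ q, q * f = g - inclCompl k i (π g) := by
    rw [← Ideal.mem_span_singleton', ← hπ, RingHom.mem_ker, map_sub, hret, sub_self]
  have hg : g = q * f + inclCompl k i (π g) := by rw [hq]; ring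
  have hc : constantCoeff (inclCompl k i (π g)) = constantCoeff (π g) := by
    have := coeff_embDomain_rename (Function.Embedding.subtype fun j : σ => j ≠ i) (π g) 0
    rwa [Finsupp.embDomain_zero] at this
  have h1 : constantCoeff (π g) = 0 := by
    rw [← hc]
    rw [hg] at hg0
    simpa [h0] using hg0
  have h2 : ∃ j, coeff (Finsupp.single j 1) (π g) ≠ 0 := by
    by_contra! hall
    apply hv'
    rw [hg, map_add, map_add, constantCoeff_directionalDerivation_mul v h0 hv, zero_add,
      constantCoeff_directionalDerivation]
    refine Finset.sum_eq_zero fun j _ => ?_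
    by_cases hji : j = i
    · rw [coeff_inclCompl_eq_zero _ (by simp [hji]), mul_zero]
    · have := coeff_embDomain_rename (Function.Embedding.subtype fun j : σ => j ≠ i) (π g)
        (Finsupp.single ⟨j, hji⟩ 1)
      rw [Finsupp.embDomain_single, hall] at this
      erw [this]
      rw [mul_zero]
  have h3 : Ideal.span {f, g} = (Ideal.span {π g}).comap π := by
    have hsurj : Function.Surjective π := fun r => ⟨_, hret r⟩
    have h4 : Ideal.map π (Ideal.span {g}) = Ideal.span {π g} := by
      rw [Ideal.map_span, Set.image_singleton]
    rw [← h4, Ideal.comap_map_of_surjective' π hsurj, hπ, Ideal.span_insert, sup_comm]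
  rw [h3]
  have := isPrime_span_singleton h1 h2
  exact Ideal.comap_isPrime π _

end MvPowerSeries

/-! ### Determinantal representations over formal power series -/

namespace DetRep

variable {k : Type*} [Field k] {n : ℕ}

theorem formalLinearPart_apply (φ : MvPowerSeries (Fin n) k) (v : Fin n → k) :
    formalLinearPart φ v =
      MvPowerSeries.constantCoeff (MvPowerSeries.directionalDerivation v φ) := by
  rw [MvPowerSeries.constantCoeff_directionalDerivation]
  simp [formalLinearPart, mul_comm]

theorem FormalSmooth.exists_coeff_ne_zero {φ : MvPowerSeries (Fin n) k} (h : FormalSmooth φ) :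
    ∃ i, MvPowerSeries.coeff (Finsupp.single i 1) φ ≠ 0 := by
  by_contra! hall
  exact h.2 (by simp [formalLinearPart, hall])

theorem primeOrder_prod_of_formalSmooth [CharZero k] {r : ℕ}
    {f : Fin r → MvPowerSeries (Fin n) k} (hf : ∀ a, FormalSmooth (f a))
    (p : Ideal (MvPowerSeries (Fin n) k)) [hp : p.IsPrime] (S : Finset (Fin r))
    (hS : ∀ a, a ∈ S ↔ f a ∈ p) : primeOrder p (∏ a, f a) = S.card := by
  -- A direction transversal to all components at once; it exists because `k` is infinite.
  obtain ⟨v, hv⟩ := Module.Dual.exists_forall_ne_zero_of_forall_exists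
    (fun a => (formalLinearPart (f a) : Module.Dual k (Fin n → k))) fun a => by
      by_contra! h
      exact (hf a).2 (LinearMap.ext h)
  have hunit : ∀ x : MvPowerSeries (Fin n) k, MvPowerSeries.constantCoeff x ≠ 0 → x ∉ p :=
    fun x hx hxp => hp.ne_top (Ideal.eq_top_of_isUnit_mem _ hxp
      (MvPowerSeries.isUnit_iff_constantCoeff.2 (isUnit_iff_ne_zero.2 hx)))
  refine primeOrder_prod (MvPowerSeries.directionalDerivation v) p
    (fun m hm => hunit _ (by simpa using hm)) f Finset.univ S (by simpa using hS) fun a _ => ?_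
  refine hunit _ ?_
  have := hv a
  rwa [formalLinearPart_apply] at this

theorem corank_diagonal {K m : Type*} [Field K] [Fintype m] [DecidableEq m]
    (w : m → K) (S : Finset m) (hS : ∀ a, a ∈ S ↔ w a = 0) :
    corank (Matrix.diagonal w) = S.card := by
  classical
  rw [corank, Matrix.rank_diagonal, Fintype.card_subtype]
  have h1 := Finset.card_filter_add_card_filter_not (s := (Finset.univ : Finset m))
      (fun i => w i = 0)
  have h2 : Finset.univ.filter (fun i => w i = 0) = S := by ext; simp [hS]
  rw [h2, Finset.card_univ] at h1
  simp only [ne_eq]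
  omega

theorem isDetRep_diagonal {R k : Type*} [CommRing R] [Field k] {r : ℕ} {ev : R → k}
    (h0 : ev 0 = 0) {f : Fin r → R} (hf : ∀ a, ev (f a) = 0) :
    IsDetRep ev (∏ a, f a) (Matrix.diagonal f) := by
  refine ⟨fun i j => ?_, by rw [Matrix.det_diagonal]⟩
  by_cases hij : i = j
  · subst hij; simp [hf]
  · simp [hij, h0]

theorem specMaxGen_diagonal [CharZero k] {r : ℕ}
    {f : Fin r → MvPowerSeries (Fin n) k} (hf : ∀ a, FormalSmooth (f a)) :
    SpecMaxGen (Matrix.diagonal f) := by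
  classical
  intro p _
  rw [Matrix.det_diagonal, primeOrder_prod_of_formalSmooth hf p
    (Finset.univ.filter fun a => f a ∈ p) (by simp), Matrix.diagonal_map (map_zero _),
    corank_diagonal _ (Finset.univ.filter fun a => f a ∈ p)]
  intro a
  simp [Ideal.algebraMap_residueField_eq_zero]

theorem formal_locallyEquivalent_diagonal [CharZero k] {r d : ℕ}
    {f : Fin r → MvPowerSeries (Fin n) k} (hf : ∀ a, FormalSmooth (f a))
    (hfg : ∀ a b, a ≠ b → FormalNonTangent (f a) (f b))
    {M : Matrix (Fin d) (Fin d) (MvPowerSeries (Fin n) k)}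
    (hM : IsDetRep (fun a => MvPowerSeries.constantCoeff a) (∏ a, f a) M) (hgen : SpecMaxGen M) :
    LocallyEquivalent M (Matrix.diagonal f) := by
  classical
  have : IsDomain (MvPowerSeries (Fin n) k) := NoZeroDivisors.to_isDomain _
  have hprime : ∀ a, (Ideal.span {f a}).IsPrime := fun a =>
    MvPowerSeries.isPrime_span_singleton (hf a).1 (hf a).exists_coeff_ne_zero
  have hvec : ∀ a b, b ≠ a → ∃ v : Fin n → k,
      MvPowerSeries.constantCoeff (MvPowerSeries.directionalDerivation v (f a)) = 0 ∧
      MvPowerSeries.constantCoeff (MvPowerSeries.directionalDerivation v (f b)) ≠ 0 := by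
    intro a b hab
    obtain ⟨v, h1, h2⟩ := exists_mem_ker_ne_zero (hf b).2 (hfg a b hab.symm)
    exact ⟨v, by rwa [← formalLinearPart_apply], by rwa [← formalLinearPart_apply]⟩
  have hne : ∀ a b, b ≠ a → f b ∉ Ideal.span {f a} := by
    intro a b hab
    obtain ⟨v, h1, h2⟩ := hvec a b hab
    exact MvPowerSeries.notMem_span_singleton (hf a).1 h1 h2
  have hpair : ∀ a b, b ≠ a → (Ideal.span {f a, f b}).IsPrime := by
    intro a b hab
    obtain ⟨v, h1, h2⟩ := hvec a b hab
    exact MvPowerSeries.isPrime_span_pair (hf a).1 (hf a).exists_coeff_ne_zero (hf b).1 h1 h2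
  have hcorank : ∀ (p : Ideal (MvPowerSeries (Fin n) k)) [p.IsPrime],
      Fintype.card (Fin d) - (M.map (algebraMap _ p.ResidueField)).rank =
        (Finset.univ.filter fun a => f a ∈ p).card := by
    intro p _
    have h1 := hgen p
    rw [primeOrder_eq_of_associated p hM.2, primeOrder_prod_of_formalSmooth hf p
      (Finset.univ.filter fun a => f a ∈ p) (by simp)] at h1
    exact_mod_cast h1
  refine locallyEquivalent_diagonal (MvPowerSeries.constantCoeff (σ := Fin n) (R := k))
    (fun a ha => MvPowerSeries.isUnit_iff_constantCoeff.2 (isUnit_iff_ne_zero.2 ha)) f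
    (fun a => ?_) (fun a b hab h => ?_) M hM.1 hM.2 ?_ fun a =>
    Matrix.adjugate_mem_span_pair_prod_erase f a (hprime a) (hpair a) (hne a) M ?_
  · refine (Ideal.span_singleton_prime fun h => ?_).1 (hprime a)
    exact (hf a).2 (by simp [formalLinearPart, h])
  · exact hne a b hab.symm (Ideal.mem_span_singleton.2 h)
  -- At the closed point `M` vanishes, so its corank there is `d`.
  · have hker : (RingHom.ker (MvPowerSeries.constantCoeff (σ := Fin n) (R := k))).IsPrime :=
      RingHom.ker_isPrime _
    have h1 := hcorank (RingHom.ker (MvPowerSeries.constantCoeff (σ := Fin n) (R := k)))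
    have h2 : M.map (algebraMap _ (RingHom.ker
        (MvPowerSeries.constantCoeff (σ := Fin n) (R := k))).ResidueField) = 0 := by
      ext i j
      rw [Matrix.map_apply, Matrix.zero_apply, Ideal.algebraMap_residueField_eq_zero]
      exact hM.1 i j
    rw [h2, Matrix.rank_zero, Fintype.card_fin, Nat.sub_zero] at h1
    rw [h1]
    exact (Finset.card_le_univ _).trans (by simp)
  · rintro p _ - s hs
    have h1 := hcorank p
    have h2 : s.card ≤ (Finset.univ.filter fun a => f a ∈ p).card :=
      Finset.card_le_card fun c hc => by simp [hs c hc]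
    have h3 := (M.map (algebraMap _ p.ResidueField)).rank_le_card_width
    omega

end DetRep

/-! ### Hadamard's lemma for analytic functions -/

section Hadamard

variable {k E : Type*} [NontriviallyNormedField k] [NormedAddCommGroup E] [NormedSpace k E]

namespace ContinuousMultilinearMap

/-- Currying of the first variable, as a continuous linear map. -/
noncomputable def curryLeftL (k E : Type*) [NontriviallyNormedField k] [NormedAddCommGroup E]
    [NormedSpace k E] (m : ℕ) :
    (E [×(m + 1)]→L[k] k) →L[k] (E →L[k] (E [×m]→L[k] k)) :=
  (continuousMultilinearCurryLeftEquiv k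
    (fun _ : Fin (m + 1) => E) k).toContinuousLinearEquiv.toContinuousLinearMap

/-- Uncurrying of the first variable, as a continuous linear map. -/
noncomputable def uncurryLeftL (k E : Type*) [NontriviallyNormedField k] [NormedAddCommGroup E]
    [NormedSpace k E] (m : ℕ) :
    (E →L[k] (E [×m]→L[k] k)) →L[k] (E [×(m + 1)]→L[k] k) :=
  (continuousMultilinearCurryLeftEquiv k
    (fun _ : Fin (m + 1) => E) k).symm.toContinuousLinearEquiv.toContinuousLinearMap

theorem curryLeftL_apply (m : ℕ) (g : E [×(m + 1)]→L[k] k) : curryLeftL k E m g = g.curryLeft := rfl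

theorem norm_uncurryLeftL (m : ℕ) (g : E →L[k] (E [×m]→L[k] k)) :
    ‖uncurryLeftL k E m g‖ = ‖g‖ :=
  (continuousMultilinearCurryLeftEquiv k (fun _ : Fin (m + 1) => E) k).symm.norm_map g

theorem uncurryLeftL_apply (m : ℕ) (g : E →L[k] (E [×m]→L[k] k)) (x : E) :
    uncurryLeftL k E m g (fun _ => x) = g x (fun _ => x) := rfl

/-- Let `P` be the projection along a vector `e`, so that `x = P x + c x • e`. For a multilinear
form `g` this is the form representing `(g(x, …, x) - g(P x, …, P x)) / c x`, namely the sum of the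
`g(P x, …, P x, e, x, …, x)`; see `apply_sub_apply_eq_dividedDifference`. It is built as a
continuous linear map in `g`, by recursion on the degree. -/
noncomputable def dividedDifference (P : E →L[k] E) (e : E) :
    (m : ℕ) → (E [×(m + 1)]→L[k] k) →L[k] (E [×m]→L[k] k)
  | 0 => (ContinuousLinearMap.apply k (E [×0]→L[k] k) e).comp (curryLeftL k E 0)
  | m + 1 => (ContinuousLinearMap.apply k (E [×(m + 1)]→L[k] k) e).comp (curryLeftL k E (m + 1)) +
      (uncurryLeftL k E m).comp
        (((ContinuousLinearMap.compL k E (E [×(m + 1)]→L[k] k) (E [×m]→L[k] k))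
          (dividedDifference P e m)).comp
        (((ContinuousLinearMap.compL k E E (E [×(m + 1)]→L[k] k)).flip P).comp
        (curryLeftL k E (m + 1))))

theorem dividedDifference_zero_apply (P : E →L[k] E) (e : E) (g : E [×1]→L[k] k) :
    dividedDifference P e 0 g = g.curryLeft e := rfl

theorem dividedDifference_succ_apply (P : E →L[k] E) (e : E) (m : ℕ) (g : E [×(m + 2)]→L[k] k) :
    dividedDifference P e (m + 1) g = g.curryLeft e +
      uncurryLeftL k E m ((dividedDifference P e m).comp ((curryLeftL k E (m + 1) g).comp P)) := rfl

theorem norm_dividedDifference_le (P : E →L[k] E) (e : E) {K : ℝ} (hK : 1 ≤ K) (hP : ‖P‖ ≤ K)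
    (m : ℕ) : ‖dividedDifference P e m‖ ≤ ‖e‖ * ((m + 1) * K ^ m) := by
  have hcurry : ∀ (m : ℕ) (g : E [×(m + 1)]→L[k] k), ‖g.curryLeft e‖ ≤ ‖e‖ * ‖g‖ := fun m g => by
    refine (ContinuousLinearMap.le_opNorm _ _).trans ?_
    rw [ContinuousMultilinearMap.curryLeft_norm, mul_comm]
  induction m with
  | zero =>
    refine ContinuousLinearMap.opNorm_le_bound _ (by positivity) fun g => ?_
    rw [dividedDifference_zero_apply]
    simpa using hcurry 0 g
  | succ m ih =>
    refine ContinuousLinearMap.opNorm_le_bound _ (by positivity) fun g => ?_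
    rw [dividedDifference_succ_apply]
    have h1 : ‖uncurryLeftL k E m
        ((dividedDifference P e m).comp ((curryLeftL k E (m + 1) g).comp P))‖ ≤
        ‖e‖ * ((m + 1) * K ^ m) * (‖g‖ * K) := by
      rw [norm_uncurryLeftL]
      refine (ContinuousLinearMap.opNorm_comp_le _ _).trans ?_
      refine mul_le_mul ih ((ContinuousLinearMap.opNorm_comp_le _ _).trans ?_) (norm_nonneg _)
        (by positivity)
      rw [curryLeftL_apply, ContinuousMultilinearMap.curryLeft_norm]
      exact mul_le_mul_of_nonneg_left hP (norm_nonneg _)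
    refine (norm_add_le _ _).trans ((add_le_add (hcurry _ g) h1).trans ?_)
    have h2 : ‖e‖ * ‖g‖ ≤ ‖e‖ * ‖g‖ * K ^ (m + 1) :=
      le_mul_of_one_le_right (by positivity) (one_le_pow₀ hK)
    push_cast
    calc _ ≤ ‖e‖ * ‖g‖ * K ^ (m + 1) + ‖e‖ * ((m + 1) * K ^ m) * (‖g‖ * K) := by gcongr
      _ = _ := by ring

theorem apply_sub_apply_eq_dividedDifference {P : E →L[k] E} {e : E} {c : E → k} {x : E}
    (hx : x = P x + c x • e) (m : ℕ) (g : E [×(m + 1)]→L[k] k) :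
    g (fun _ => x) - g (fun _ => P x) = c x * dividedDifference P e m g (fun _ => x) := by
  have hsub : x - P x = c x • e := by rw [sub_eq_iff_eq_add']; exact hx
  have hcurry : ∀ (m : ℕ) (g : E [×(m + 1)]→L[k] k) (z : E),
      g (fun _ => z) = g.curryLeft z (fun _ => z) := fun m g z => by
    rw [curryLeft_apply]
    congr 1
    ext i
    refine Fin.cases ?_ (fun _ => ?_) i <;> simp
  induction m with
  | zero =>
    rw [dividedDifference_zero_apply, hcurry _ _ x, hcurry _ _ (P x),
      Subsingleton.elim (fun _ : Fin 0 => P x) (fun _ => x), ← sub_apply, ← map_sub, hsub, map_smul]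
    rfl
  | succ m ih =>
    rw [dividedDifference_succ_apply, add_apply, mul_add]
    have h1 := uncurryLeftL_apply m
      ((dividedDifference P e m).comp ((curryLeftL k E (m + 1) g).comp P)) x
    have h2 := ih (g.curryLeft (P x))
    have h3 : g.curryLeft x = g.curryLeft (P x) + c x • g.curryLeft e := by
      rw [← map_smul, ← map_add, ← hx]
    rw [hcurry _ g x, hcurry _ g (P x), h1, h3, add_apply, smul_apply, smul_eq_mul]
    rw [ContinuousLinearMap.comp_apply, ContinuousLinearMap.comp_apply, curryLeftL_apply, ← h2]
    ring

end ContinuousMultilinearMap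

/-- **Hadamard's lemma** over a complete field: if `x - P x = c x • e`, then `h - h ∘ P` is
divisible by `c` in the ring of analytic germs at the origin. There is no integration over a
general `k`; the power series of `h` is divided term by term. -/
theorem AnalyticAt.exists_sub_comp_eq_mul {P : E →L[k] E} {e : E} {c : E → k} [CompleteSpace k]
    (hP : ∀ x, x = P x + c x • e) {h : E → k} (hh : AnalyticAt k h 0) :
    ∃ q : E → k, AnalyticAt k q 0 ∧ ∀ᶠ x in 𝓝 0, h x - h (P x) = c x * q x := by
  obtain ⟨p, hp⟩ := hh
  obtain ⟨R, hR⟩ := hp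
  obtain ⟨r, hr0, hrR⟩ := ENNReal.lt_iff_exists_nnreal_btwn.1 hR.r_pos
  have hr0 : 0 < r := by exact_mod_cast hr0
  obtain ⟨C, hC, hCp⟩ := p.norm_mul_pow_le_of_lt_radius (hrR.trans_le hR.r_le)
  let Q : FormalMultilinearSeries k E k := fun m =>
    ContinuousMultilinearMap.dividedDifference P e m (p (m + 1))
  set K : NNReal := max 1 ‖P‖₊ with hK
  have hK1 : (1 : ℝ) ≤ K := by exact_mod_cast le_max_left _ _
  have hKP : ‖P‖ ≤ K := by exact_mod_cast le_max_right 1 ‖P‖₊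
  have hK0 : (0 : ℝ) < K := lt_of_lt_of_le one_pos hK1
  have hr0' : (0 : ℝ) < r := by exact_mod_cast hr0
  -- The factor `m + 1` in the bound for the norm of the divided difference is at most `2 ^ m`.
  have hQ : 0 < Q.radius := by
    refine lt_of_lt_of_le ?_ (Q.le_radius_of_bound (‖e‖ * C / r) (r := r / (2 * K)) fun m => ?_)
    · have : 0 < r / (2 * K) := by
        have : 0 < K := by exact_mod_cast hK0
        positivity
      exact_mod_cast this
    · have h1 : ‖Q m‖ ≤ ‖e‖ * ((m + 1) * (K : ℝ) ^ m) * ‖p (m + 1)‖ :=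
        (ContinuousLinearMap.le_opNorm _ _).trans (mul_le_mul_of_nonneg_right
          (ContinuousMultilinearMap.norm_dividedDifference_le P e hK1 hKP m) (norm_nonneg _))
      have h2 : ((m : ℝ) + 1) ≤ 2 ^ m := by exact_mod_cast Nat.succ_le_of_lt Nat.lt_two_pow_self
      have h3 := hCp (m + 1)
      rw [NNReal.coe_div, NNReal.coe_mul, NNReal.coe_ofNat]
      calc ‖Q m‖ * ((r : ℝ) / (2 * K)) ^ m
          ≤ ‖e‖ * ((m + 1) * (K : ℝ) ^ m) * ‖p (m + 1)‖ * ((r : ℝ) / (2 * K)) ^ m := by gcongr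
        _ ≤ ‖e‖ * (2 ^ m * (K : ℝ) ^ m) * ‖p (m + 1)‖ * ((r : ℝ) / (2 * K)) ^ m := by gcongr
        _ = ‖e‖ * (‖p (m + 1)‖ * (r : ℝ) ^ (m + 1)) / r := by
          rw [div_pow, mul_pow, pow_succ]
          field_simp
        _ ≤ ‖e‖ * C / r := by gcongr
  have hQs := Q.hasFPowerSeriesOnBall hQ
  refine ⟨Q.sum, hQs.analyticAt, ?_⟩
  have hPt : Tendsto P (𝓝 0) (𝓝 0) := by simpa using P.continuous.tendsto 0
  have hb1 := Metric.eball_mem_nhds (0 : E) hR.r_pos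
  have hb2 := Metric.eball_mem_nhds (0 : E) hQ
  filter_upwards [hb1, hPt hb1, hb2] with x hx1 hx2 hx3
  have s1 := hR.hasSum (y := x) hx1
  have s2 := hR.hasSum (y := P x) hx2
  have s3 := hQs.hasSum (y := x) hx3
  simp only [zero_add] at s1 s2 s3
  have s4 := (hasSum_nat_add_iff' 1).2 (s1.sub s2)
  simp only [Finset.range_one, Finset.sum_singleton] at s4
  rw [Subsingleton.elim (fun _ : Fin 0 => P x) (fun _ => x), sub_self, sub_zero] at s4
  refine s4.unique ?_
  have h5 : ∀ m, p (m + 1) (fun _ => x) - p (m + 1) (fun _ => P x) = c x * Q m fun _ => x :=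
    fun m => ContinuousMultilinearMap.apply_sub_apply_eq_dividedDifference (hP x) m (p (m + 1))
  simpa only [h5] using s3.mul_left (c x)

end Hadamard

/-! ### An analytic retraction onto a smooth zero set -/

section Retraction

variable {k E ι : Type*} [NontriviallyNormedField k] [CompleteSpace k] [NormedAddCommGroup E]
  [NormedSpace k E] [DecidableEq ι]

/-- Hadamard's lemma for a projection along several vectors. -/
theorem AnalyticAt.exists_sub_comp_eq_sum_mul (ℓ : ι → E →L[k] k) (e : ι → E)
    (hℓ : ∀ i j, ℓ i (e j) = if i = j then 1 else 0) {h : E → k} (hh : AnalyticAt k h 0)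
    (s : Finset ι) :
    ∃ q : ι → E → k, (∀ i, AnalyticAt k (q i) 0) ∧
      ∀ᶠ x in 𝓝 0, h x - h (x - ∑ i ∈ s, ℓ i x • e i) = ∑ i ∈ s, ℓ i x * q i x := by
  induction s using Finset.induction_on with
  | empty => exact ⟨fun _ => 0, fun _ => analyticAt_const, by simp⟩
  | insert b s hb ih =>
    obtain ⟨q, hq, hqs⟩ := ih
    let Pb : E →L[k] E := ContinuousLinearMap.id k E - (ℓ b).smulRight (e b)
    let Ps : E →L[k] E := ContinuousLinearMap.id k E - ∑ i ∈ s, (ℓ i).smulRight (e i)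
    have hPs : ∀ x, Ps x = x - ∑ i ∈ s, ℓ i x • e i := fun x => by
      simp [Ps]
    obtain ⟨u, hu, hue⟩ := hh.exists_sub_comp_eq_mul (P := Pb) (e := e b) (c := ℓ b)
      (fun x => by simp [Pb])
    have hPt : Tendsto Ps (𝓝 0) (𝓝 0) := by simpa using Ps.continuous.tendsto 0
    refine ⟨Function.update q b (u ∘ Ps), fun i => ?_, ?_⟩
    · by_cases hib : i = b
      · subst hib
        rw [Function.update_self]
        exact AnalyticAt.comp (by simpa using hu) (Ps.analyticAt 0)
      · rw [Function.update_of_ne hib]; exact hq i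
    · filter_upwards [hqs, hPt.eventually hue] with x h1 h2
      have h3 : ℓ b (Ps x) = ℓ b x := by
        rw [hPs, map_sub, map_sum, Finset.sum_eq_zero, sub_zero]
        intro i hi
        rw [map_smul, hℓ, if_neg (by rintro rfl; exact hb hi), smul_zero]
      have h4 : Pb (Ps x) = x - ∑ i ∈ insert b s, ℓ i x • e i := by
        rw [Finset.sum_insert hb]
        have : Pb (Ps x) = Ps x - ℓ b (Ps x) • e b := rfl
        rw [this, h3, hPs]; abel
      rw [h3, h4, hPs] at h2
      rw [Finset.sum_insert hb (f := fun i => ℓ i x * Function.update q b (u ∘ Ps) i x),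
        Function.update_self, Function.comp_apply, hPs, ← h2,
        Finset.sum_congr rfl (g := fun i => ℓ i x * q i x), ← h1]
      · ring
      · intro i hi
        rw [Function.update_of_ne (by rintro rfl; exact hb hi)]

/-- Functions with independent differentials at the origin: there is an analytic retraction `ρ` onto
their zero set such that every `h - h ∘ ρ` is in the ideal they generate. In the coordinates `Φ`, in
which the functions are the linear forms `ℓ`, the retraction is a linear projection. -/
theorem AnalyticAt.exists_retraction [Fintype ι] [CompleteSpace E] {f : ι → E → k}
    (hf : ∀ i, AnalyticAt k (f i) 0) (h0 : ∀ i, f i 0 = 0) {e : ι → E}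
    (he : ∀ i j, fderiv k (f i) 0 (e j) = if i = j then 1 else 0) :
    ∃ ρ : E → E, AnalyticAt k ρ 0 ∧ ρ 0 = 0 ∧ (∀ᶠ x in 𝓝 0, ∀ i, f i (ρ x) = 0) ∧
      ∀ h : E → k, AnalyticAt k h 0 → ∃ q : ι → E → k, (∀ i, AnalyticAt k (q i) 0) ∧
        ∀ᶠ x in 𝓝 0, h x - h (ρ x) = ∑ i, f i x * q i x := by
  let ℓ : ι → E →L[k] k := fun i => fderiv k (f i) 0
  let Φ : E → E := fun x => x + ∑ i, (f i x - ℓ i x) • e i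
  let P : E →L[k] E := ContinuousLinearMap.id k E - ∑ i, (ℓ i).smulRight (e i)
  have hPx : ∀ x, P x = x - ∑ i, ℓ i x • e i := fun x => by
    simp [P]
  have hΦ0 : Φ 0 = 0 := by simp [Φ, h0]
  have hΦa : AnalyticAt k Φ 0 := by
    refine analyticAt_id.add (Finset.analyticAt_fun_sum _ fun i _ => ?_)
    exact ((hf i).sub ((ℓ i).analyticAt 0)).smul analyticAt_const
  have hΦd : HasStrictFDerivAt Φ (ContinuousLinearEquiv.refl k E : E →L[k] E) 0 := by
    have h1 : HasFDerivAt Φ (ContinuousLinearMap.id k E +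
        ∑ i, (fderiv k (f i) 0 - ℓ i).smulRight (e i)) 0 := by
      refine (hasFDerivAt_id _).add (HasFDerivAt.fun_sum fun i _ => ?_)
      exact (((hf i).differentiableAt.hasFDerivAt).sub (ℓ i).hasFDerivAt).smul_const (e i)
    have h2 : ContinuousLinearMap.id k E + ∑ i, (fderiv k (f i) 0 - ℓ i).smulRight (e i) =
        (ContinuousLinearEquiv.refl k E : E →L[k] E) := by
      ext x; simp [ℓ]
    rw [h2] at h1
    have h3 := hΦa.hasStrictFDerivAt
    rwa [h1.fderiv] at h3
  let T := hΦd.toOpenPartialHomeomorph Φ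
  have hT0 : (0 : E) ∈ T.source := hΦd.mem_toOpenPartialHomeomorph_source
  have hTΦ : ⇑T = Φ := hΦd.toOpenPartialHomeomorph_coe
  let Ψ : E → E := T.symm
  have hΨ0 : Ψ 0 = 0 := by
    have := T.left_inv hT0
    rwa [hTΦ, hΦ0] at this
  have hΨa : AnalyticAt k Ψ 0 := by
    have := T.analyticAt_symm' hT0 (by rwa [hTΦ])
      (i := ContinuousLinearEquiv.refl k E) (by rw [hTΦ]; exact hΦd.hasFDerivAt.fderiv)
    rwa [hTΦ, hΦ0] at this
  have hΨΦ : ∀ᶠ x in 𝓝 0, Ψ (Φ x) = x := by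
    filter_upwards [T.open_source.mem_nhds hT0] with x hx
    have := T.left_inv hx
    rwa [hTΦ] at this
  have hΦΨ : ∀ᶠ x in 𝓝 0, Φ (Ψ x) = x := by
    have h0t : (0 : E) ∈ T.target := by
      have := T.map_source hT0
      rwa [hTΦ, hΦ0] at this
    filter_upwards [T.open_target.mem_nhds h0t] with x hx
    have := T.right_inv hx
    rwa [hTΦ] at this
  have hℓΦ : ∀ i x, ℓ i (Φ x) = f i x := by
    intro i x
    simp only [Φ, map_add, map_sum, map_smul, ℓ, he]
    simp
  have hPΦ : ∀ x, P (Φ x) = Φ x - ∑ i, f i x • e i := fun x => by simp only [hPx, hℓΦ]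
  have hΦt : Tendsto Φ (𝓝 0) (𝓝 0) := by simpa [hΦ0] using hΦa.continuousAt.tendsto
  have hPΦt : Tendsto (fun x => P (Φ x)) (𝓝 0) (𝓝 0) := by
    have := (P.continuous.tendsto 0).comp hΦt
    rwa [map_zero] at this
  refine ⟨fun x => Ψ (P (Φ x)), ?_, by simp [hΦ0, hΨ0], ?_, fun h hh => ?_⟩
  · refine AnalyticAt.comp (g := Ψ) (by simpa [hΦ0] using hΨa) ?_
    exact AnalyticAt.comp (g := P) (P.analyticAt _) hΦa
  · filter_upwards [hPΦt.eventually hΦΨ] with x hx i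
    rw [← hℓΦ, hx, hPx, map_sub, map_sum]
    simp [ℓ, he]
  · obtain ⟨q, hq, hqe⟩ := AnalyticAt.exists_sub_comp_eq_sum_mul ℓ e he
      (h := fun x => h (Ψ x)) (AnalyticAt.comp (g := h) (by simpa [hΨ0] using hh) hΨa) Finset.univ
    refine ⟨fun i x => q i (Φ x), fun i => AnalyticAt.comp (g := q i) (by simpa [hΦ0] using hq i)
      hΦa, ?_⟩
    filter_upwards [hΦt.eventually hqe, hΨΦ] with x h1 h2
    rw [← hPx, h2] at h1
    simpa only [hℓΦ] using h1

end Retraction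

/-! ### Orders of vanishing along lines -/

section Order

open Asymptotics

variable {k : Type*} [NontriviallyNormedField k]

theorem Polynomial.coeff_eq_zero_of_isBigO {P : Polynomial k} {N : ℕ}
    (h : (fun t => P.eval t) =O[𝓝 0] fun t => t ^ N) {j : ℕ} (hj : j < N) : P.coeff j = 0 := by
  suffices hN : (Polynomial.X : Polynomial k) ^ N ∣ P from Polynomial.X_pow_dvd_iff.1 hN j hj
  by_cases hP : P = 0
  · simp [hP]
  obtain ⟨Q, hQ, hQX⟩ := P.exists_eq_pow_rootMultiplicity_mul_and_not_dvd hP 0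
  set m := P.rootMultiplicity 0
  rw [Polynomial.C_0, sub_zero] at hQ hQX
  by_cases hNm : N ≤ m
  · rw [hQ]; exact (pow_dvd_pow _ hNm).mul_right _
  exfalso
  apply hQX
  rw [Polynomial.X_dvd_iff, Polynomial.coeff_zero_eq_eval_zero]
  have h1 : (fun t => Q.eval t) =O[𝓝[≠] 0] fun t => t ^ (N - m) := by
    obtain ⟨C, hC⟩ := h.bound
    refine IsBigO.of_bound C ?_
    filter_upwards [hC.filter_mono nhdsWithin_le_nhds, self_mem_nhdsWithin] with t ht ht0
    have ht0 : t ≠ 0 := ht0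
    rw [hQ, Polynomial.eval_mul, Polynomial.eval_pow, Polynomial.eval_X,
      ← Nat.add_sub_cancel' (le_of_not_ge hNm), pow_add, norm_mul, norm_mul,
      mul_left_comm] at ht
    exact le_of_mul_le_mul_left ht (norm_pos_iff.2 (pow_ne_zero _ ht0))
  have h2 : Tendsto (fun t : k => t ^ (N - m)) (𝓝[≠] 0) (𝓝 0) := by
    have : Tendsto (fun t : k => t ^ (N - m)) (𝓝 0) (𝓝 (0 ^ (N - m))) :=
      (continuous_pow _).tendsto 0
    rw [zero_pow (by omega)] at this
    exact this.mono_left nhdsWithin_le_nhds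
  have h3 : Tendsto (fun t => Q.eval t) (𝓝[≠] 0) (𝓝 (Q.eval 0)) :=
    (Q.continuous.tendsto 0).mono_left nhdsWithin_le_nhds
  exact tendsto_nhds_unique h3 (h1.trans_tendsto h2)

variable {E : Type*} [NormedAddCommGroup E] [NormedSpace k E]

theorem HasFPowerSeriesAt.isBigO_line {g : E → k} {p : FormalMultilinearSeries k E k} {x : E}
    (hg : HasFPowerSeriesAt g p x) (v : E) (N : ℕ) :
    (fun t : k => g (x + t • v) - ∑ j ∈ Finset.range N, t ^ j * p j fun _ => v) =O[𝓝 0]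
      fun t => t ^ N := by
  have h1 : Tendsto (fun t : k => t • v) (𝓝 0) (𝓝 0) := by
    have : Tendsto (fun t : k => t • v) (𝓝 0) (𝓝 ((0 : k) • v)) :=
      (continuous_id.smul continuous_const).tendsto 0
    rwa [zero_smul] at this
  have h2 := (hg.isBigO_sub_partialSum_pow N).comp_tendsto h1
  refine (h2.congr_left fun t => ?_).trans (IsBigO.of_bound (‖v‖ ^ N) ?_)
  · have h3 : ∀ j, (p j fun _ => t • v) = t ^ j * p j fun _ => v := fun j => by
      rw [(p j).map_smul_univ (fun _ => t) (fun _ => v)]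
      simp
    simp [FormalMultilinearSeries.partialSum, h3]
  · refine Eventually.of_forall fun t => le_of_eq ?_
    simp [norm_smul, mul_pow, mul_comm]

/-- A function vanishes to order `N` along the line through `x` with direction `v` if and only if
the terms of degree less than `N` of its power series vanish on `v`. -/
theorem HasFPowerSeriesAt.isBigO_line_iff {g : E → k} {p : FormalMultilinearSeries k E k} {x : E}
    (hg : HasFPowerSeriesAt g p x) (v : E) (N : ℕ) :
    ((fun t : k => g (x + t • v)) =O[𝓝 0] fun t => t ^ N) ↔ ∀ j < N, (p j fun _ => v) = 0 := by
  have h1 := hg.isBigO_line v N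
  constructor
  · intro h j hj
    let P : Polynomial k :=
      ∑ j ∈ Finset.range N, Polynomial.C (p j fun _ => v) * Polynomial.X ^ j
    have h2 : (fun t => P.eval t) =O[𝓝 0] fun t => t ^ N := by
      refine (h.sub h1).congr_left fun t => ?_
      rw [sub_sub_cancel, Polynomial.eval_finsetSum]
      exact Finset.sum_congr rfl fun i _ => by
        rw [Polynomial.eval_mul, Polynomial.eval_C, Polynomial.eval_pow, Polynomial.eval_X,
          mul_comm]
    have h3 := Polynomial.coeff_eq_zero_of_isBigO h2 hj
    simpa [P, Polynomial.finsetSum_coeff, Polynomial.coeff_C_mul, Polynomial.coeff_X_pow, hj]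
      using h3
  · intro h
    refine h1.congr_left fun t => ?_
    rw [Finset.sum_eq_zero, sub_zero]
    intro j hj
    rw [h j (Finset.mem_range.1 hj), mul_zero]

/-- The terms of a power series need not be symmetric, but the iterated derivatives depend on the
homogeneous polynomials `v ↦ p j (v, …, v)` only: a term vanishing on the diagonal can be
dropped. -/
theorem HasFPowerSeriesAt.iteratedFDeriv_eq_zero [CompleteSpace k] {g : E → k}
    {p : FormalMultilinearSeries k E k} {x : E} (hg : HasFPowerSeriesAt g p x) {j : ℕ}
    (hj : ∀ v, (p j fun _ => v) = 0) : iteratedFDeriv k j g x = 0 := by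
  obtain ⟨r, hr⟩ := hg
  let p' : FormalMultilinearSeries k E k := fun i => if i = j then 0 else p i
  have hp' : ∀ i v, (p' i fun _ => v) = p i fun _ => v := fun i v => by
    by_cases h : i = j
    · subst h; simp [p', hj]
    · simp [p', h]
  have hr' : HasFPowerSeriesOnBall g p' x r := by
    refine ⟨hr.r_le.trans ?_, hr.r_pos, fun {y} hy => by simpa only [hp'] using hr.hasSum hy⟩
    refine FormalMultilinearSeries.radius_le_of_le fun i => ?_
    by_cases h : i = j
    · simp [p', h]
    · simp [p', h]
  ext v
  rw [hr'.iteratedFDeriv_eq_sum_of_completeSpace]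
  simp [p']

end Order

namespace DetRep

open Asymptotics

variable {k : Type*} [NontriviallyNormedField k] {n : ℕ}

theorem vanishingOrder_congr {g g' : (Fin n → k) → k} {x : Fin n → k} (h : g =ᶠ[𝓝 x] g') :
    vanishingOrder g x = vanishingOrder g' x := by
  simp only [vanishingOrder, (h.iteratedFDeriv k _).self_of_nhds]

theorem tendsto_line_div {f : (Fin n → k) → k} {x : Fin n → k} (hf : DifferentiableAt k f x)
    (h0 : f x = 0) (v : Fin n → k) :
    Tendsto (fun t : k => f (x + t • v) / t) (𝓝[≠] 0) (𝓝 (fderiv k f x v)) := by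
  have h1 := (hf.hasFDerivAt.hasLineDerivAt v)
  have h2 := hasDerivAt_iff_tendsto_slope_zero.1 h1
  refine h2.congr fun t => ?_
  simp [h0, div_eq_inv_mul]

variable [CompleteSpace k]

theorem le_vanishingOrder {g : (Fin n → k) → k} {x : Fin n → k} (hg : AnalyticAt k g x) {s : ℕ}
    (h : ∀ v, (fun t : k => g (x + t • v)) =O[𝓝 0] fun t => t ^ s) :
    (s : ℕ∞) ≤ vanishingOrder g x := by
  obtain ⟨p, hp⟩ := hg
  refine le_iInf₂ fun j hj => ?_
  by_contra! hlt
  have hlt : j < s := by exact_mod_cast hlt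
  exact hj (hp.iteratedFDeriv_eq_zero fun v => (hp.isBigO_line_iff v s).1 (h v) j hlt)

theorem vanishingOrder_le [CharZero k] {g : (Fin n → k) → k} {x v : Fin n → k}
    (hg : AnalyticAt k g x) {s : ℕ}
    (h : ¬ (fun t : k => g (x + t • v)) =O[𝓝 0] fun t => t ^ (s + 1)) :
    vanishingOrder g x ≤ s := by
  obtain ⟨p, hp⟩ := hg
  rw [hp.isBigO_line_iff] at h
  push Not at h
  obtain ⟨j, hj, hne⟩ := h
  refine (iInf₂_le j fun h0 => ?_).trans (by exact_mod_cast Nat.le_of_lt_succ hj)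
  obtain ⟨r, hr⟩ := hp
  have h1 := hr.factorial_smul v j
  rw [h0, nsmul_eq_mul, zero_apply] at h1
  exact hne ((mul_eq_zero.1 h1).resolve_left (by exact_mod_cast Nat.factorial_ne_zero j))

/-- If the functions `f a`, `a ∈ S`, vanish at `x` with nonzero derivative along one and the same
direction `v`, then their product, times a function that is not zero at `x`, has order of vanishing
`S.card`. -/
theorem vanishingOrder_mul_prod [CharZero k] {ι : Type*} {S : Finset ι}
    {f : ι → (Fin n → k) → k} {w : (Fin n → k) → k} {x v : Fin n → k}
    (hw : AnalyticAt k w x) (hw0 : w x ≠ 0) (hf : ∀ a ∈ S, AnalyticAt k (f a) x)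
    (hf0 : ∀ a ∈ S, f a x = 0) (hv : ∀ a ∈ S, fderiv k (f a) x v ≠ 0) :
    vanishingOrder (fun y => w y * ∏ a ∈ S, f a y) x = S.card := by
  have hg : AnalyticAt k (fun y => w y * ∏ a ∈ S, f a y) x :=
    hw.mul (Finset.analyticAt_fun_prod _ hf)
  have hline : ∀ (v : Fin n → k), Tendsto (fun t : k => x + t • v) (𝓝 0) (𝓝 x) := fun v => by
    have : Tendsto (fun t : k => x + t • v) (𝓝 0) (𝓝 (x + (0 : k) • v)) :=
      (continuous_const.add (continuous_id.smul continuous_const)).tendsto 0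
    simpa using this
  have hlim : ∀ v, Tendsto (fun t : k => (w (x + t • v) * ∏ a ∈ S, f a (x + t • v)) / t ^ S.card)
      (𝓝[≠] 0) (𝓝 (w x * ∏ a ∈ S, fderiv k (f a) x v)) := by
    intro v
    have h1 : Tendsto (fun t : k => w (x + t • v) * ∏ a ∈ S, (f a (x + t • v) / t)) (𝓝[≠] 0)
        (𝓝 (w x * ∏ a ∈ S, fderiv k (f a) x v)) := by
      refine Tendsto.mul ?_ (tendsto_finsetProd _ fun a ha =>
        tendsto_line_div (hf a ha).differentiableAt (hf0 a ha) v)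
      exact (hw.continuousAt.tendsto.comp (hline v)).mono_left nhdsWithin_le_nhds
    refine h1.congr fun t => ?_
    rw [Finset.prod_div_distrib, Finset.prod_const, mul_div_assoc]
  apply le_antisymm
  · refine vanishingOrder_le (v := v) hg fun h => ?_
    have h1 : Tendsto (fun t : k => (w (x + t • v) * ∏ a ∈ S, f a (x + t • v)) / t ^ S.card)
        (𝓝[≠] 0) (𝓝 0) := by
      obtain ⟨C, hC⟩ := h.bound
      have h2 : (fun t : k => (w (x + t • v) * ∏ a ∈ S, f a (x + t • v)) / t ^ S.card)
          =O[𝓝[≠] 0] fun t => t := by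
        refine IsBigO.of_bound C ?_
        filter_upwards [hC.filter_mono nhdsWithin_le_nhds, self_mem_nhdsWithin] with t ht ht0
        have ht0 : 0 < ‖t‖ := norm_pos_iff.2 ht0
        rw [norm_div, norm_pow, div_le_iff₀ (pow_pos ht0 _)]
        refine ht.trans (le_of_eq ?_)
        rw [norm_pow, pow_succ]; ring
      exact h2.trans_tendsto (tendsto_id.mono_left nhdsWithin_le_nhds)
    have h2 := tendsto_nhds_unique (hlim v) h1
    exact mul_ne_zero hw0 (Finset.prod_ne_zero_iff.2 hv) h2
  · refine le_vanishingOrder hg fun v => ?_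
    have h1 := (hlim v).isBigO_one k
    have h2 : (fun t : k => w (x + t • v) * ∏ a ∈ S, f a (x + t • v)) =O[𝓝[≠] 0]
        fun t => t ^ S.card := by
      obtain ⟨C, hC⟩ := h1.bound
      refine IsBigO.of_bound C ?_
      filter_upwards [hC, self_mem_nhdsWithin] with t ht ht0
      have ht0 : 0 < ‖t‖ := norm_pos_iff.2 ht0
      rw [norm_div, norm_pow, div_le_iff₀ (pow_pos ht0 _)] at ht
      simpa using ht
    obtain ⟨C, hC⟩ := h2.bound
    refine IsBigO.of_bound (max C (‖w x * ∏ a ∈ S, f a x‖)) ?_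
    rw [eventually_nhdsWithin_iff] at hC
    filter_upwards [hC] with t ht
    by_cases ht0 : t = 0
    · subst ht0
      by_cases hS : S = ∅
      · simp [hS]
      · have : ∏ a ∈ S, f a x = 0 := by
          obtain ⟨a, ha⟩ := Finset.nonempty_iff_ne_empty.2 hS
          exact Finset.prod_eq_zero ha (hf0 a ha)
        simp only [zero_smul, add_zero, this, mul_zero, norm_zero]
        positivity
    · exact (ht ht0).trans (mul_le_mul_of_nonneg_right (le_max_left _ _) (norm_nonneg _))

/-- At all points near the origin, the order of vanishing of a product of smooth functions is the
number of factors that vanish. -/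
theorem eventually_vanishingOrder_eq [CharZero k] {r : ℕ}
    {f : Fin r → (Fin n → k) → k} {w g : (Fin n → k) → k}
    (hw : AnalyticAt k w 0) (hw0 : w 0 ≠ 0) (hf : ∀ a, AnalyticAt k (f a) 0)
    (hf' : ∀ a, fderiv k (f a) 0 ≠ 0) (hg : g =ᶠ[𝓝 0] fun x => w x * ∏ a, f a x) :
    ∀ᶠ x in 𝓝 0, ∀ S : Finset (Fin r), (∀ a, a ∈ S ↔ f a x = 0) →
      vanishingOrder g x = S.card := by
  classical
  obtain ⟨v, hv⟩ := Module.Dual.exists_forall_ne_zero_of_forall_exists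
    (fun a => ((fderiv k (f a) 0 : (Fin n → k) →ₗ[k] k) : Module.Dual k (Fin n → k))) fun a => by
      by_contra! h
      exact hf' a (ContinuousLinearMap.ext h)
  have hfd : ∀ a, ∀ᶠ x in 𝓝 0, fderiv k (f a) x v ≠ 0 := fun a => by
    have h1 : ContinuousAt (fun x => fderiv k (f a) x v) 0 :=
      (hf a).fderiv.continuousAt.clm_apply continuousAt_const
    exact h1.eventually_ne (hv a)
  filter_upwards [eventually_all.2 fun a => (hf a).eventually_analyticAt,
    hw.eventually_analyticAt, eventually_all.2 hfd, hw.continuousAt.eventually_ne hw0,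
    hg.eventually_nhds] with x h1 h2 h3 h4 h5 S hS
  rw [vanishingOrder_congr h5]
  have h6 : (fun x => w x * ∏ a, f a x) =
      fun x => (w x * ∏ a ∈ Finset.univ \ S, f a x) * ∏ a ∈ S, f a x := by
    ext y
    rw [mul_assoc, Finset.prod_sdiff (Finset.subset_univ S)]
  rw [h6]
  refine vanishingOrder_mul_prod (v := v) (h2.mul (Finset.analyticAt_fun_prod _ fun a _ => h1 a))
    (mul_ne_zero h4 (Finset.prod_ne_zero_iff.2 fun a ha h0 => ?_)) (fun a _ => h1 a)
    (fun a ha => (hS a).1 ha) (fun a _ => h3 a)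
  exact (Finset.mem_sdiff.1 ha).2 ((hS a).2 h0)

end DetRep

/-! ### Rings of germs of analytic functions -/

namespace DetRep

section Taylor

variable {k : Type*} [NontriviallyNormedField k] {n : ℕ}

theorem exists_mvPolynomial_eval_eq {m : ℕ}
    (g : ContinuousMultilinearMap k (fun _ : Fin m => Fin n → k) k) :
    ∃ P : MvPolynomial (Fin n) k, ∀ x, MvPolynomial.eval x P = g fun _ => x := by
  refine ⟨∑ s : Fin m → Fin n, MvPolynomial.C (g fun j => Pi.single (s j) 1) *
    ∏ j, MvPolynomial.X (s j), fun x => ?_⟩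
  have hx : x = ∑ i, x i • (Pi.single i 1 : Fin n → k) := by
    ext l; simp [Finset.sum_apply, Pi.single_apply]
  have h1 : (g fun _ => x) = ∑ s : Fin m → Fin n, g fun j => x (s j) • Pi.single (s j) 1 := by
    conv_lhs => rw [hx]
    exact g.toMultilinearMap.map_sum (fun _ i => x i • (Pi.single i 1 : Fin n → k))
  rw [h1, map_sum]
  refine Finset.sum_congr rfl fun s _ => ?_
  rw [g.map_smul_univ]
  simp [mul_comm]

/-- The ring of germs of analytic functions has no zero divisors. Outside the zero set of a nonzero
polynomial, the restriction of a nonzero germ to a line through the origin is nonzero, which reduces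
the claim to one variable. -/
theorem eventually_eq_zero_or_of_mul {a b : (Fin n → k) → k} (ha : AnalyticAt k a 0)
    (hb : AnalyticAt k b 0) (hab : ∀ᶠ x in 𝓝 0, a x * b x = 0) :
    (∀ᶠ x in 𝓝 0, a x = 0) ∨ ∀ᶠ x in 𝓝 0, b x = 0 := by
  have key : ∀ {a : (Fin n → k) → k}, AnalyticAt k a 0 → (¬ ∀ᶠ x in 𝓝 0, a x = 0) →
      ∃ A : MvPolynomial (Fin n) k, A ≠ 0 ∧
        ∀ x, MvPolynomial.eval x A ≠ 0 → ∀ᶠ t : k in 𝓝[≠] 0, a (t • x) ≠ 0 := by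
    rintro a ⟨p, hp⟩ ha
    obtain ⟨m, y, hm⟩ : ∃ m y, (p m fun _ => y) ≠ 0 := by
      by_contra! hall
      apply ha
      obtain ⟨R, hR⟩ := hp
      filter_upwards [Metric.eball_mem_nhds (0 : Fin n → k) hR.r_pos] with x hx
      have h1 := hR.hasSum (y := x) hx
      simp only [hall, zero_add] at h1
      exact h1.unique hasSum_zero
    obtain ⟨A, hA⟩ := exists_mvPolynomial_eval_eq (p m)
    refine ⟨A, fun h0 => hm (by rw [← hA, h0, map_zero]), fun x hx => ?_⟩
    have hline : AnalyticAt k (fun t : k => a (t • x)) 0 := by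
      refine AnalyticAt.comp (g := a) (by simpa using hp.analyticAt) ?_
      exact analyticAt_id.smul analyticAt_const
    refine hline.eventually_eq_zero_or_eventually_ne_zero.resolve_left fun h0 => hx ?_
    rw [hA]
    refine (hp.isBigO_line_iff x (m + 1)).1 ?_ m (Nat.lt_succ_self m)
    refine (Asymptotics.isBigO_zero _ _).congr' ?_ EventuallyEq.rfl
    filter_upwards [h0] with t ht
    rw [zero_add, ht]
  by_contra h
  rw [not_or] at h
  obtain ⟨A, hA, hA'⟩ := key ha h.1
  obtain ⟨B, hB, hB'⟩ := key hb h.2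
  obtain ⟨x, hx⟩ : ∃ x, MvPolynomial.eval x (A * B) ≠ 0 := by
    by_contra! hall
    exact mul_ne_zero hA hB (MvPolynomial.funext fun x => by rw [hall, map_zero])
  rw [map_mul] at hx
  have hline : Tendsto (fun t : k => t • x) (𝓝[≠] 0) (𝓝 0) := by
    have : Tendsto (fun t : k => t • x) (𝓝 0) (𝓝 ((0 : k) • x)) :=
      (continuous_id.smul continuous_const).tendsto 0
    rw [zero_smul] at this
    exact this.mono_left nhdsWithin_le_nhds
  obtain ⟨t, h1, h2, h3⟩ := ((hline.eventually hab).and ((hA' x (left_ne_zero_of_mul hx)).and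
    (hB' x (right_ne_zero_of_mul hx)))).exists
  exact mul_ne_zero h2 h3 h1

end Taylor

section Reps

variable {k : Type*} [NontriviallyNormedField k] {n : ℕ}

theorem germValue_coe (g : (Fin n → k) → k) : germValue (g : FunGerm k n) = g 0 := rfl

theorem germLinearPart_coe_apply (g : (Fin n → k) → k) (v : Fin n → k) :
    germLinearPart (g : FunGerm k n) v = fderiv k g 0 v := rfl

/-- The value at the origin, as a ring homomorphism on a ring of germs. -/
noncomputable def valueHom (O : Subring (FunGerm k n)) : O →+* k :=
  (Germ.valueRingHom (x := (0 : Fin n → k)) (E := k)).comp O.subtype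

theorem valueHom_apply (O : Subring (FunGerm k n)) (a : O) : valueHom O a = germValue a.val := rfl

variable {O : Subring (FunGerm k n)}

/-- The function `g` represents the element `a` of a ring of germs. -/
def IsRep (a : O) (g : (Fin n → k) → k) : Prop := a.val = (g : FunGerm k n)

theorem IsRep.eventually_eq {a : O} {g g' : (Fin n → k) → k} (h : IsRep a g) (h' : IsRep a g') :
    g =ᶠ[𝓝 0] g' := Germ.coe_eq.1 (h.symm.trans h')

theorem IsRep.add {a b : O} {g h : (Fin n → k) → k} (ha : IsRep a g) (hb : IsRep b h) :
    IsRep (a + b) (fun x => g x + h x) := by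
  unfold IsRep at *
  rw [Subring.coe_add, ha, hb]; rfl

theorem IsRep.mul {a b : O} {g h : (Fin n → k) → k} (ha : IsRep a g) (hb : IsRep b h) :
    IsRep (a * b) (fun x => g x * h x) := by
  unfold IsRep at *
  rw [Subring.coe_mul, ha, hb]; rfl

theorem IsRep.one : IsRep (1 : O) (fun _ => 1) := rfl

theorem IsRep.zero : IsRep (0 : O) (fun _ => 0) := rfl

theorem IsRep.zsmul {a : O} {g : (Fin n → k) → k} (ha : IsRep a g) (c : ℤ) :
    IsRep (c • a) (fun x => c • g x) := by
  have h : IsRep (c : O) (fun _ => (c : k)) := rfl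
  simpa only [zsmul_eq_mul] using h.mul ha

theorem IsRep.sum {ι : Type*} (s : Finset ι) {a : ι → O} {g : ι → (Fin n → k) → k}
    (h : ∀ i ∈ s, IsRep (a i) (g i)) : IsRep (∑ i ∈ s, a i) (fun x => ∑ i ∈ s, g i x) := by
  classical
  induction s using Finset.induction_on with
  | empty => exact IsRep.zero
  | insert b s hb ih =>
    simp only [Finset.sum_insert hb]
    exact (h b (Finset.mem_insert_self _ _)).add
      (ih fun i hi => h i (Finset.mem_insert_of_mem hi))

theorem IsRep.prod {ι : Type*} (s : Finset ι) {a : ι → O} {g : ι → (Fin n → k) → k}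
    (h : ∀ i ∈ s, IsRep (a i) (g i)) : IsRep (∏ i ∈ s, a i) (fun x => ∏ i ∈ s, g i x) := by
  classical
  induction s using Finset.induction_on with
  | empty => exact IsRep.one
  | insert b s hb ih =>
    simp only [Finset.prod_insert hb]
    exact (h b (Finset.mem_insert_self _ _)).mul
      (ih fun i hi => h i (Finset.mem_insert_of_mem hi))

variable {m m' m'' : Type*}

theorem IsRep.matrix_mul [Fintype m'] {A : Matrix m m' O} {B : Matrix m' m'' O}
    {A' : (Fin n → k) → Matrix m m' k} {B' : (Fin n → k) → Matrix m' m'' k}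
    (hA : ∀ i j, IsRep (A i j) fun x => A' x i j) (hB : ∀ i j, IsRep (B i j) fun x => B' x i j)
    (i : m) (j : m'') : IsRep ((A * B) i j) fun x => (A' x * B' x) i j := by
  simp only [Matrix.mul_apply]
  exact IsRep.sum _ fun l _ => (hA i l).mul (hB l j)

theorem IsRep.det [Fintype m] [DecidableEq m] {A : Matrix m m O} {A' : (Fin n → k) → Matrix m m k}
    (hA : ∀ i j, IsRep (A i j) fun x => A' x i j) : IsRep A.det fun x => (A' x).det := by
  simp only [Matrix.det_apply, Units.smul_def]
  exact IsRep.sum _ fun σ _ => (IsRep.prod _ fun i _ => hA _ _).zsmul _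

end Reps

section AnalyticGerms

variable {k : Type*} [NontriviallyNormedField k] {n : ℕ}

theorem exists_isRep (a : analyticGerms k n) :
    ∃ g : (Fin n → k) → k, AnalyticAt k g 0 ∧ IsRep a g := a.2

theorem isDomain_of_le_analyticGerms {O : Subring (FunGerm k n)} (hO : O ≤ analyticGerms k n) :
    IsDomain O := by
  have : Nontrivial O := ⟨0, 1, fun h => by
    have := (Germ.coe_eq.1 (congrArg Subtype.val h : ((fun _ => 0 : (Fin n → k) → k) :
      FunGerm k n) = ((fun _ => 1 : (Fin n → k) → k) : FunGerm k n))).self_of_nhds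
    exact zero_ne_one this⟩
  have : NoZeroDivisors O := ⟨fun {a b} hab => by
    obtain ⟨g, hg, hag⟩ := hO a.2
    obtain ⟨h, hh, hbh⟩ := hO b.2
    have h1 : IsRep (a * b) (fun x => g x * h x) := IsRep.mul hag hbh
    rw [hab] at h1
    rcases eventually_eq_zero_or_of_mul hg hh (h1.eventually_eq IsRep.zero) with h2 | h2
    · exact Or.inl (Subtype.ext (hag.trans (Germ.coe_eq.2 h2)))
    · exact Or.inr (Subtype.ext (hbh.trans (Germ.coe_eq.2 h2)))⟩
  exact NoZeroDivisors.to_isDomain _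

variable [CompleteSpace k]

/-- Germs with independent differentials generate a prime ideal, which contains all the germs that
vanish on the common zero set. Both hold because the ideal is the kernel of the composition with the
retraction onto that zero set. -/
theorem isPrime_span_range_and_mem {ι : Type*} [Fintype ι] [DecidableEq ι]
    {f : ι → analyticGerms k n} (h0 : ∀ i, germValue (f i).val = 0) {e : ι → Fin n → k}
    (he : ∀ i j, germLinearPart (f i).val (e j) = if i = j then 1 else 0)
    {f' : ι → (Fin n → k) → k} (hf' : ∀ i, IsRep (f i) (f' i)) :
    (Ideal.span (Set.range f)).IsPrime ∧
      ∀ (h : analyticGerms k n) (h' : (Fin n → k) → k), IsRep h h' →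
        (∀ᶠ x in 𝓝 0, (∀ i, f' i x = 0) → h' x = 0) → h ∈ Ideal.span (Set.range f) := by
  have hfa : ∀ i, AnalyticAt k (f' i) 0 := fun i => by
    obtain ⟨g, hg, hfg⟩ := exists_isRep (f i)
    exact hg.congr (hfg.eventually_eq (hf' i))
  obtain ⟨ρ, hρ, hρ0, hfρ, hdiv⟩ := AnalyticAt.exists_retraction hfa
    (fun i => by have := h0 i; rwa [hf' i, germValue_coe] at this)
    (e := e) (fun i j => by have := he i j; rwa [hf' i, germLinearPart_coe_apply] at this)
  have hρt : Tendsto ρ (𝓝 0) (𝓝 0) := by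
    have := hρ.continuousAt.tendsto; rwa [hρ0] at this
  have hmem : ∀ (h : analyticGerms k n) (h' : (Fin n → k) → k), IsRep h h' →
      (h ∈ Ideal.span (Set.range f) ↔ ∀ᶠ x in 𝓝 0, h' (ρ x) = 0) := by
    intro h h' hh'
    constructor
    · intro hI
      obtain ⟨c, hc⟩ := (Ideal.mem_span_range_iff_exists_fun).1 hI
      choose c' _ hc' using fun i => exists_isRep (c i)
      have h1 : IsRep h (fun x => ∑ i, c' i x * f' i x) := by
        rw [← hc]; exact IsRep.sum _ fun i _ => (hc' i).mul (hf' i)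
      filter_upwards [hρt.eventually (hh'.eventually_eq h1), hfρ] with x h2 h3
      rw [h2]
      exact Finset.sum_eq_zero fun i _ => by rw [h3 i, mul_zero]
    · intro hz
      obtain ⟨g, hg, hhg⟩ := exists_isRep h
      have hha : AnalyticAt k h' 0 := hg.congr (hhg.eventually_eq hh')
      obtain ⟨q, hq, hqe⟩ := hdiv h' hha
      refine (Ideal.mem_span_range_iff_exists_fun).2
        ⟨fun i => ⟨(q i : FunGerm k n), q i, hq i, rfl⟩,
        Subtype.ext ?_⟩
      have h1 : IsRep (∑ i, (⟨(q i : FunGerm k n), q i, hq i, rfl⟩ : analyticGerms k n) * f i)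
          (fun x => ∑ i, q i x * f' i x) :=
        IsRep.sum _ fun i _ => IsRep.mul (g := q i) rfl (hf' i)
      refine h1.trans (Eq.trans (Germ.coe_eq.2 ?_) hh'.symm)
      filter_upwards [hz, hqe] with x h2 h3
      rw [h2, sub_zero] at h3
      rw [h3]
      exact Finset.sum_congr rfl fun i _ => mul_comm _ _
  refine ⟨⟨fun htop => ?_, fun {a b} hab => ?_⟩, fun h h' hh' hz => ?_⟩
  · have h1 := (hmem 1 _ IsRep.one).1 (htop ▸ Submodule.mem_top)
    exact one_ne_zero h1.self_of_nhds
  · obtain ⟨g, hg, hag⟩ := exists_isRep a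
    obtain ⟨h, hh, hbh⟩ := exists_isRep b
    rw [hmem a g hag, hmem b h hbh]
    exact eventually_eq_zero_or_of_mul (a := fun x => g (ρ x)) (b := fun x => h (ρ x))
      (AnalyticAt.comp (g := g) (by rwa [hρ0]) hρ) (AnalyticAt.comp (g := h) (by rwa [hρ0]) hρ)
      ((hmem _ _ (hag.mul hbh)).1 hab)
  · rw [hmem h h' hh']
    filter_upwards [hρt.eventually hz, hfρ] with x h1 h2
    exact h1 h2

end AnalyticGerms

end DetRep

/-! ### Determinantal representations over rings of analytic germs -/

namespace DetRep

variable {k : Type*} [NontriviallyNormedField k] {n r : ℕ}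

theorem germMaxGenNear_diagonal [CompleteSpace k] [CharZero k] {O : Subring (FunGerm k n)}
    (hO : O ≤ analyticGerms k n) {f : Fin r → O} (hf : ∀ a, GermSmooth (f a).val) :
    GermMaxGenNear ((Matrix.diagonal f).map O.subtype) := by
  classical
  choose f' hfa hf' using fun a => hO (f a).2
  refine ⟨fun x => Matrix.diagonal fun a => f' a x, fun i j => ?_, ?_⟩
  · rw [Matrix.map_apply]
    by_cases hij : i = j
    · subst hij; simp [hf']
    · simp only [Matrix.diagonal_apply_ne _ hij]; rfl
  · have h1 : ∀ a, fderiv k (f' a) 0 ≠ 0 := fun a h => (hf a).2 <| by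
      refine LinearMap.ext fun v => ?_
      rw [hf' a, germLinearPart_coe_apply, h]; rfl
    filter_upwards [eventually_vanishingOrder_eq (w := fun _ => 1)
      (g := fun y => (Matrix.diagonal fun a => f' a y).det)
      analyticAt_const one_ne_zero hfa h1 (.of_forall fun x => by simp)] with x hx
    have hS : ∀ a, a ∈ Finset.univ.filter (fun a => f' a x = 0) ↔ f' a x = 0 := by simp
    rw [hx _ hS, corank_diagonal _ _ hS]

theorem germLinearPart_mul {a b : FunGerm k n} {g h : (Fin n → k) → k}
    (ha : a = (g : FunGerm k n)) (hb : b = (h : FunGerm k n)) (hg : AnalyticAt k g 0)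
    (hh : AnalyticAt k h 0) (v : Fin n → k) :
    germLinearPart (a * b) v = germValue a * germLinearPart b v +
      germValue b * germLinearPart a v := by
  subst ha hb
  change fderiv k (g * h) 0 v = g 0 * fderiv k h 0 v + h 0 * fderiv k g 0 v
  rw [fderiv_mul hg.differentiableAt hh.differentiableAt]
  simp

section Span

theorem GermSmooth.notMem_span_singleton {φ ψ : analyticGerms k n} (hφ : GermSmooth φ.val)
    (hψ : GermSmooth ψ.val) (hne : GermNonTangent φ.val ψ.val) : ψ ∉ Ideal.span {φ} := by
  obtain ⟨v, hv, hv'⟩ := exists_mem_ker_ne_zero hψ.2 hne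
  intro h
  obtain ⟨q, rfl⟩ := Ideal.mem_span_singleton'.1 h
  apply hv'
  obtain ⟨g, hg, hqg⟩ := exists_isRep q
  obtain ⟨g', hg', hφg⟩ := exists_isRep φ
  rw [Subring.coe_mul, germLinearPart_mul hqg hφg hg hg', hv, hφ.1]
  simp

variable [CompleteSpace k]

theorem GermSmooth.isPrime_span_singleton {φ : analyticGerms k n} (hφ : GermSmooth φ.val) :
    (Ideal.span {φ}).IsPrime := by
  obtain ⟨v, hv⟩ : ∃ v, germLinearPart φ.val v ≠ 0 := by
    by_contra! h; exact hφ.2 (LinearMap.ext h)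
  obtain ⟨g, -, hg⟩ := exists_isRep φ
  have h1 := (isPrime_span_range_and_mem (ι := Unit) (f := fun _ => φ) (fun _ => hφ.1)
    (e := fun _ => (germLinearPart φ.val v)⁻¹ • v) (fun _ _ => by simp [hv])
    (f' := fun _ => g) (fun _ => hg)).1
  rwa [Set.range_const] at h1

theorem GermSmooth.isPrime_span_pair_and_mem {φ ψ : analyticGerms k n} (hφ : GermSmooth φ.val)
    (hψ : GermSmooth ψ.val) (hne : GermNonTangent φ.val ψ.val)
    {g h : (Fin n → k) → k} (hg : IsRep φ g) (hh : IsRep ψ h) :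
    (Ideal.span {φ, ψ}).IsPrime ∧
      ∀ (a : analyticGerms k n) (a' : (Fin n → k) → k), IsRep a a' →
        (∀ᶠ x in 𝓝 0, g x = 0 → h x = 0 → a' x = 0) → a ∈ Ideal.span {φ, ψ} := by
  obtain ⟨v, hv, hv'⟩ := exists_mem_ker_ne_zero hψ.2 hne
  obtain ⟨u, hu, hu'⟩ := exists_mem_ker_ne_zero hφ.2 (Ne.symm hne)
  have key := isPrime_span_range_and_mem (ι := Fin 2) (f := ![φ, ψ])
    (fun i => by fin_cases i; exacts [hφ.1, hψ.1])
    (e := ![(germLinearPart φ.val u)⁻¹ • u, (germLinearPart ψ.val v)⁻¹ • v])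
    (fun i j => by fin_cases i <;> fin_cases j <;> simp [hv, hu, hv', hu'])
    (f' := ![g, h]) (fun i => by fin_cases i; exacts [hg, hh])
  rw [Matrix.range_cons, Matrix.range_cons, Matrix.range_empty, Set.union_empty,
    Set.singleton_union] at key
  refine ⟨key.1, fun a a' ha hz => key.2 a a' ha ?_⟩
  filter_upwards [hz] with x hx hall
  exact hx (hall 0) (hall 1)

end Span

/-- Uniqueness over a local ring of analytic germs `O` whose ideals are contracted from the ring of
all analytic germs. -/
theorem germ_locallyEquivalent_diagonal [CompleteSpace k] [CharZero k]
    {O : Subring (FunGerm k n)} (hO : O ≤ analyticGerms k n)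
    (hunit : ∀ a : O, germValue a.val ≠ 0 → IsUnit a)
    (hcontr : ∀ (J : Ideal O) (g : O),
      Subring.inclusion hO g ∈ J.map (Subring.inclusion hO) → g ∈ J)
    {f : Fin r → O} (hf : ∀ a, GermSmooth (f a).val)
    (hfg : ∀ a b, a ≠ b → GermNonTangent (f a).val (f b).val) {d : ℕ}
    {M : Matrix (Fin d) (Fin d) O}
    (hM : IsDetRep (fun a : O => germValue a.val) (∏ a, f a) M)
    (hgen : GermMaxGenNear (M.map O.subtype)) :
    LocallyEquivalent M (Matrix.diagonal f) := by
  classical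
  have hdom := isDomain_of_le_analyticGerms hO
  let inc := Subring.inclusion hO
  choose f' hfa hf' using fun a => hO (f a).2
  have hfrep : ∀ a, IsRep (inc (f a)) (f' a) := hf'
  obtain ⟨F, hF, hFgen⟩ := hgen
  have hMF : ∀ i j, IsRep (M i j) fun x => F x i j := hF
  -- Near the origin, the corank is the number of the components passing through the point.
  have hcorank : ∀ᶠ x in 𝓝 0, ∀ S : Finset (Fin r), (∀ a, a ∈ S ↔ f' a x = 0) →
      corank (F x) = S.card := by
    obtain ⟨u, hu⟩ := hM.2.symm
    obtain ⟨w, hw, huw⟩ := hO u.val.2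
    have hw0 : w 0 ≠ 0 := by
      have := (u.isUnit.map (valueHom O)).ne_zero
      rw [valueHom_apply, huw] at this
      exact this
    have h1 : (fun y => (F y).det) =ᶠ[𝓝 0] fun x => w x * ∏ a, f' a x := by
      refine (IsRep.det hMF).eventually_eq ?_
      rw [← hu, mul_comm]
      exact IsRep.mul huw (IsRep.prod _ fun a _ => hf' a)
    have h2 : ∀ a, fderiv k (f' a) 0 ≠ 0 := fun a h => (hf a).2 <| by
      refine LinearMap.ext fun v => ?_
      rw [hf' a, germLinearPart_coe_apply, h]; rfl
    filter_upwards [hFgen, eventually_vanishingOrder_eq hw hw0 hfa h2 h1] with x h3 h4 S hS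
    rw [h4 S hS] at h3
    exact_mod_cast h3
  have hF0 : F 0 = 0 := by
    ext i j
    have h1 : germValue (M i j).val = 0 := hM.1 i j
    rw [show (M i j).val = _ from hMF i j] at h1
    exact h1
  have hd : d = (Finset.univ.filter fun a => f' a 0 = 0).card := by
    have h1 := hcorank.self_of_nhds (Finset.univ.filter fun a => f' a 0 = 0) (by simp)
    rwa [corank, hF0, Matrix.rank_zero, Fintype.card_fin, Nat.sub_zero] at h1
  have hdr : d ≤ r := by
    rw [hd]; exact (Finset.card_le_univ _).trans (by simp)
  have hrd : r ≤ d := by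
    rw [hd, Finset.filter_true_of_mem, Finset.card_univ, Fintype.card_fin]
    intro a _
    have := (hf a).1
    rwa [hf' a, germValue_coe] at this
  have hprime : ∀ a, (Ideal.span {inc (f a)}).IsPrime := fun a =>
    GermSmooth.isPrime_span_singleton (hf a)
  have hne : ∀ a b, b ≠ a → inc (f b) ∉ Ideal.span {inc (f a)} := fun a b hab =>
    GermSmooth.notMem_span_singleton (φ := inc (f a)) (ψ := inc (f b)) (hf a) (hf b)
      (hfg a b hab.symm)
  have hpair := fun a b (hab : b ≠ a) =>
    GermSmooth.isPrime_span_pair_and_mem (φ := inc (f a)) (ψ := inc (f b)) (hf a) (hf b)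
      (hfg a b hab.symm) (hfrep a) (hfrep b)
  have hmapspan : ∀ s : Set O, (Ideal.span s).map inc = Ideal.span (inc '' s) := fun s =>
    Ideal.map_span _ _
  refine locallyEquivalent_diagonal (valueHom O) hunit f (fun a => ?_) (fun a b hab h => ?_) M
    hM.1 hM.2 hdr fun a i j => hcontr _ _ ?_
  · have h0 : f a ≠ 0 := fun h0 => (hf a).2 <| by
      refine LinearMap.ext fun v => ?_
      rw [h0]; change fderiv k (fun _ => (0 : k)) 0 v = 0; simp
    rw [← Ideal.span_singleton_prime h0]
    have h1 : Ideal.span {f a} = (Ideal.span {inc (f a)}).comap inc := by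
      have h2 := hmapspan {f a}
      rw [Set.image_singleton] at h2
      rw [← h2]
      exact le_antisymm Ideal.le_comap_map fun g hg => hcontr _ g hg
    rw [h1]
    have := hprime a
    exact Ideal.comap_isPrime inc _
  · obtain ⟨q, hq⟩ := h
    refine hne a b hab.symm ?_
    rw [hq, map_mul]
    exact Ideal.mul_mem_right _ _ (Ideal.mem_span_singleton_self _)
  -- The adjugate is studied over the ring of all analytic germs, where a germ vanishing on
  -- `{f a = f b = 0}` belongs to the ideal `(f a, f b)`.
  · change inc (M.adjugate i j) ∈ Ideal.map inc _
    rw [hmapspan, Set.image_pair, map_prod]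
    have hadj : inc (M.adjugate i j) = (M.map inc).adjugate i j := by
      rw [← RingHom.mapMatrix_apply, ← RingHom.map_adjugate]; rfl
    rw [hadj]
    refine Matrix.adjugate_mem_span_pair_prod_erase (fun a => inc (f a)) a (hprime a)
      (fun b hb => (hpair a b hb).1) (hne a) (M.map inc) ?_ i j
    rintro p hp ⟨b, hb, rfl⟩ s hs
    have hsd : s.card ≤ d := (Finset.card_le_univ s).trans (by simpa using hrd)
    have hlt := Matrix.rank_lt_of_forall_det_mem (Ideal.span {inc (f a), inc (f b)}) (M.map inc)
      (d - s.card + 1) fun U V => ?_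
    · rw [Fintype.card_fin]; omega
    choose U' _ hU' using fun i j => exists_isRep (U i j)
    choose V' _ hV' using fun i j => exists_isRep (V i j)
    refine (hpair a b hb).2 _ _ (IsRep.det (A' := fun x => Matrix.of (fun i j => U' i j x) * F x *
      Matrix.of (fun i j => V' i j x)) fun i j => IsRep.matrix_mul (IsRep.matrix_mul
        (A' := fun x => Matrix.of (fun i j => U' i j x)) hU' (B' := F) hMF)
        (B' := fun x => Matrix.of (fun i j => V' i j x)) hV' i j) ?_
    have hs' : ∀ c ∈ s, ∀ᶠ x in 𝓝 0, f' a x = 0 → f' b x = 0 → f' c x = 0 := by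
      intro c hc
      obtain ⟨y, z, hyz⟩ := Ideal.mem_span_pair.1 (hs c hc)
      obtain ⟨y', _, hy⟩ := exists_isRep y
      obtain ⟨z', _, hz⟩ := exists_isRep z
      have h1 := (hy.mul (hfrep a)).add (hz.mul (hfrep b))
      rw [hyz] at h1
      filter_upwards [(hfrep c).eventually_eq h1] with x hx ha hb
      rw [hx, ha, hb]; simp
    -- At a point of `{f a = f b = 0}` the corank of `M` is at least `s.card`, so that the rank of
    -- `U * M * V` is less than its size `d - s.card + 1`.
    filter_upwards [hcorank, (s.eventually_all).2 hs'] with x h1 h2 ha hb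
    have h3 := h1 (Finset.univ.filter fun c => f' c x = 0) (by simp)
    have h4 : s.card ≤ (Finset.univ.filter fun c => f' c x = 0).card :=
      Finset.card_le_card fun c hc => by simp [h2 c hc ha hb]
    by_contra hdet
    have h5 := Matrix.rank_of_isUnit _ ((Matrix.isUnit_iff_isUnit_det _).2
      (isUnit_iff_ne_zero.2 hdet))
    have h6 := (Matrix.rank_mul_le_left (Matrix.of (fun i j => U' i j x) * F x)
      (Matrix.of (fun i j => V' i j x))).trans
      (Matrix.rank_mul_le_right (Matrix.of (fun i j => U' i j x)) (F x))
    rw [h5, Fintype.card_fin] at h6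
    have h7 := (F x).rank_le_card_width
    rw [Fintype.card_fin] at h7
    rw [corank, Fintype.card_fin] at h3
    omega

end DetRep

/-! ### Rational functions that are regular at the origin -/

namespace DetRep

open Asymptotics

section Polynomials

variable {k : Type*} [NontriviallyNormedField k] {n : ℕ}

theorem eval_smul_of_isHomogeneous {P : MvPolynomial (Fin n) k} {j : ℕ} (hP : P.IsHomogeneous j)
    (t : k) (x : Fin n → k) :
    MvPolynomial.eval (t • x) P = t ^ j * MvPolynomial.eval x P := by
  rw [MvPolynomial.eval_eq', MvPolynomial.eval_eq', Finset.mul_sum]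
  refine Finset.sum_congr rfl fun d hd => ?_
  have h1 : ∑ i, d i = j := by
    have := hP (MvPolynomial.mem_support_iff.1 hd)
    simpa [Finsupp.weight_apply, Finsupp.sum_fintype] using this
  simp only [Pi.smul_apply, smul_eq_mul, mul_pow, Finset.prod_mul_distrib,
    Finset.prod_pow_eq_pow_sum, h1]
  ring

/-- A polynomial of size `O(‖x‖ ^ N)` has no terms of degree less than `N`, as one sees on the lines
through the origin. -/
theorem mem_pow_idealOfVars_of_isBigO {P : MvPolynomial (Fin n) k} {N : ℕ}
    (h : (fun x => MvPolynomial.eval x P) =O[𝓝 0] fun x => ‖x‖ ^ N) :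
    P ∈ MvPolynomial.idealOfVars (Fin n) k ^ N := by
  have key : ∀ j < N, MvPolynomial.homogeneousComponent j P = 0 := by
    intro j hj
    by_cases hjD : j < P.totalDegree + 1
    swap
    · exact MvPolynomial.homogeneousComponent_eq_zero _ _ (by omega)
    refine MvPolynomial.funext fun x => ?_
    let Q : Polynomial k := ∑ i ∈ Finset.range (P.totalDegree + 1),
      Polynomial.C (MvPolynomial.eval x (MvPolynomial.homogeneousComponent i P)) *
        Polynomial.X ^ i
    have hQ : ∀ t, Q.eval t = MvPolynomial.eval (t • x) P := fun t => by
      conv_rhs => rw [← MvPolynomial.sum_homogeneousComponent P]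
      rw [map_sum, Polynomial.eval_finsetSum]
      refine Finset.sum_congr rfl fun i _ => ?_
      rw [eval_smul_of_isHomogeneous (MvPolynomial.homogeneousComponent_isHomogeneous i P),
        Polynomial.eval_mul, Polynomial.eval_C, Polynomial.eval_pow, Polynomial.eval_X, mul_comm]
    have hline : Tendsto (fun t : k => t • x) (𝓝 0) (𝓝 0) := by
      have : Tendsto (fun t : k => t • x) (𝓝 0) (𝓝 ((0 : k) • x)) :=
        (continuous_id.smul continuous_const).tendsto 0
      rwa [zero_smul] at this
    have h2 : (fun t => Q.eval t) =O[𝓝 0] fun t => t ^ N := by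
      refine ((h.comp_tendsto hline).congr_left fun t => (hQ t).symm).trans
        (IsBigO.of_bound (‖x‖ ^ N) (Eventually.of_forall fun t => le_of_eq ?_))
      simp [norm_smul, mul_pow, mul_comm]
    have h3 := Polynomial.coeff_eq_zero_of_isBigO h2 hj
    rw [map_zero, ← h3]
    simp [Q, Polynomial.finsetSum_coeff, Polynomial.coeff_C_mul, Polynomial.coeff_X_pow, hjD]
  rw [MvPolynomial.mem_pow_idealOfVars_iff']
  intro μ hμ
  have := congrArg (MvPolynomial.coeff μ) (key _ hμ)
  rwa [MvPolynomial.coeff_homogeneousComponent, if_pos rfl, MvPolynomial.coeff_zero] at this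

/-- Taylor expansion of an analytic function at the origin. -/
theorem exists_mvPolynomial_isBigO {g : (Fin n → k) → k} (hg : AnalyticAt k g 0) (N : ℕ) :
    ∃ P : MvPolynomial (Fin n) k,
      (fun x => g x - MvPolynomial.eval x P) =O[𝓝 0] fun x => ‖x‖ ^ N := by
  obtain ⟨p, hp⟩ := hg
  choose P hP using fun j => exists_mvPolynomial_eval_eq (p j)
  refine ⟨∑ j ∈ Finset.range N, P j, ?_⟩
  refine (hp.isBigO_sub_partialSum_pow N).congr_left fun x => ?_
  simp [FormalMultilinearSeries.partialSum, hP]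

end Polynomials

section Rational

variable {k : Type*} [NontriviallyNormedField k] {n : ℕ}

theorem analyticAt_mvPolynomial_eval [CompleteSpace k] (p : MvPolynomial (Fin n) k)
    (x : Fin n → k) : AnalyticAt k (fun x => MvPolynomial.eval x p) x :=
  (AnalyticOnNhd.eval_mvPolynomial p) x (Set.mem_univ x)

theorem rationalGerms_le_analyticGerms [CompleteSpace k] :
    rationalGerms k n ≤ analyticGerms k n := by
  rintro _ ⟨p, q, hq, rfl⟩
  exact ⟨_, (analyticAt_mvPolynomial_eval p 0).div (analyticAt_mvPolynomial_eval q 0) hq, rfl⟩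

/-- The germ of a polynomial. -/
noncomputable def polynomialGerm : MvPolynomial (Fin n) k →+* rationalGerms k n where
  toFun p := ⟨((fun x => MvPolynomial.eval x p : (Fin n → k) → k) : FunGerm k n), p, 1, by simp,
    Germ.coe_eq.2 (.of_forall fun x => by simp)⟩
  map_one' := Subtype.ext (Germ.coe_eq.2 (.of_forall fun x => by simp))
  map_mul' p q := Subtype.ext (Germ.coe_eq.2 (.of_forall fun x => by simp))
  map_zero' := Subtype.ext (Germ.coe_eq.2 (.of_forall fun x => by simp))
  map_add' p q := Subtype.ext (Germ.coe_eq.2 (.of_forall fun x => by simp))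

theorem isRep_polynomialGerm (p : MvPolynomial (Fin n) k) :
    IsRep (polynomialGerm p) fun x => MvPolynomial.eval x p := rfl

theorem isUnit_of_mem_rationalGerms {a : rationalGerms k n} (ha : germValue a.val ≠ 0) :
    IsUnit a := by
  obtain ⟨_, p, q, hq, rfl⟩ := a
  have hp : MvPolynomial.eval 0 p ≠ 0 := fun h => ha (by rw [germValue_coe, h, zero_div])
  refine IsUnit.of_mul_eq_one ⟨_, q, p, hp, rfl⟩ (Subtype.ext (Germ.coe_eq.2 ?_))
  filter_upwards [eventually_eval_ne_zero hp, eventually_eval_ne_zero hq] with x h1 h2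
  simp [h1, h2]

theorem exists_mul_polynomialGerm (a : rationalGerms k n) :
    ∃ p q : MvPolynomial (Fin n) k, IsUnit (polynomialGerm q) ∧
      a * polynomialGerm q = polynomialGerm p := by
  obtain ⟨_, p, q, hq, rfl⟩ := a
  refine ⟨p, q, isUnit_of_mem_rationalGerms hq, Subtype.ext (Germ.coe_eq.2 ?_)⟩
  filter_upwards [eventually_eval_ne_zero hq] with x h
  exact div_mul_cancel₀ _ h

instance isNoetherianRing_rationalGerms : IsNoetherianRing (rationalGerms k n) := by
  refine (isNoetherianRing_iff_ideal_fg _).2 fun J => ?_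
  have h : J = (J.comap polynomialGerm).map polynomialGerm := by
    refine le_antisymm (fun a ha => ?_) Ideal.map_comap_le
    obtain ⟨p, q, hq, hpq⟩ := exists_mul_polynomialGerm a
    rw [← Ideal.mul_unit_mem_iff_mem _ hq, hpq]
    refine Ideal.mem_map_of_mem _ ?_
    rw [Ideal.mem_comap, ← hpq]
    exact Ideal.mul_mem_right _ _ ha
  rw [h]
  exact Ideal.FG.map (IsNoetherian.noetherian (J.comap polynomialGerm)) polynomialGerm

theorem mem_pow_ker_of_isBigO {a : rationalGerms k n} {g : (Fin n → k) → k} (hg : IsRep a g)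
    {N : ℕ} (h : g =O[𝓝 0] fun x => ‖x‖ ^ N) :
    a ∈ RingHom.ker (valueHom (rationalGerms k n)) ^ N := by
  obtain ⟨p, q, hq, hpq⟩ := exists_mul_polynomialGerm a
  rw [← Ideal.mul_unit_mem_iff_mem _ hq, hpq]
  have h1 : (fun x => MvPolynomial.eval x p) =O[𝓝 0] fun x => ‖x‖ ^ N := by
    have h2 : IsRep (polynomialGerm p) fun x => g x * MvPolynomial.eval x q := by
      rw [← hpq]; exact hg.mul (isRep_polynomialGerm q)
    have h3 : (fun x => MvPolynomial.eval x q) =O[𝓝 0] fun _ => (1 : ℝ) :=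
      ((MvPolynomial.continuous_eval q).tendsto 0).isBigO_one ℝ
    refine ((h.mul h3).congr_right fun x => mul_one _).congr' ?_ EventuallyEq.rfl
    exact h2.eventually_eq (isRep_polynomialGerm p)
  have h4 := Ideal.mem_map_of_mem polynomialGerm (mem_pow_idealOfVars_of_isBigO h1)
  rw [Ideal.map_pow] at h4
  refine Ideal.pow_right_mono ?_ N h4
  rw [MvPolynomial.idealOfVars, Ideal.map_span, Ideal.span_le]
  rintro _ ⟨_, ⟨i, rfl⟩, rfl⟩
  change germValue (polynomialGerm (MvPolynomial.X i)).val = 0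
  rw [isRep_polynomialGerm, germValue_coe, MvPolynomial.eval_X]; rfl

/-- Krull's intersection theorem: ideals are closed in the `𝔪`-adic topology. -/
theorem mem_of_forall_exists_sub_mem_pow (J : Ideal (rationalGerms k n)) (g : rationalGerms k n)
    (h : ∀ N, ∃ j ∈ J, g - j ∈ RingHom.ker (valueHom (rationalGerms k n)) ^ N) : g ∈ J := by
  have : IsLocalHom (valueHom (rationalGerms k n)) :=
    ⟨fun a ha => isUnit_of_mem_rationalGerms ha.ne_zero⟩
  have : IsLocalRing (rationalGerms k n) := RingHom.domain_isLocalRing (valueHom _)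
  have h1 := Ideal.iInf_pow_smul_eq_bot_of_isLocalRing (M := rationalGerms k n ⧸ J)
    (RingHom.ker (valueHom (rationalGerms k n))) (RingHom.ker_ne_top _)
  rw [← Ideal.Quotient.eq_zero_iff_mem, ← Submodule.mem_bot (R := rationalGerms k n), ← h1,
    Submodule.mem_iInf]
  intro N
  obtain ⟨j, hj, hgj⟩ := h N
  have h2 : Ideal.Quotient.mk J g = (g - j) • (1 : rationalGerms k n ⧸ J) := by
    rw [Algebra.smul_def, mul_one, Ideal.Quotient.algebraMap_eq, map_sub,
      Ideal.Quotient.eq_zero_iff_mem.2 hj, sub_zero]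
  rw [h2]
  exact Submodule.smul_mem_smul hgj Submodule.mem_top

/-- Ideals of the ring of rational functions regular at the origin are contracted from the ring of
analytic germs. A relation `g = ∑ aᵢ jᵢ` with analytic `aᵢ` gives, on replacing the `aᵢ` by Taylor
polynomials, elements of `J` that approximate `g` to arbitrary order. -/
theorem mem_of_inclusion_mem_map [CompleteSpace k] (J : Ideal (rationalGerms k n))
    (g : rationalGerms k n)
    (hg : Subring.inclusion rationalGerms_le_analyticGerms g ∈
      J.map (Subring.inclusion rationalGerms_le_analyticGerms)) : g ∈ J := by
  refine mem_of_forall_exists_sub_mem_pow J g fun N => ?_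
  suffices key : ∀ h ∈ J.map (Subring.inclusion (rationalGerms_le_analyticGerms (k := k) (n := n))),
      ∃ j ∈ J, ∀ h' j' : (Fin n → k) → k, IsRep h h' → IsRep j j' →
        (fun x => h' x - j' x) =O[𝓝 0] fun x => ‖x‖ ^ N by
    obtain ⟨j, hj, hO⟩ := key _ hg
    obtain ⟨g', -, hg'⟩ := rationalGerms_le_analyticGerms g.2
    obtain ⟨j', -, hj'⟩ := rationalGerms_le_analyticGerms j.2
    refine ⟨j, hj, mem_pow_ker_of_isBigO (g := fun x => g' x - j' x) ?_ (hO g' j' hg' hj')⟩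
    change (g - j).val = _
    rw [AddSubgroupClass.coe_sub]
    exact congrArg₂ (· - ·) hg' hj'
  intro h hh
  refine Submodule.span_induction ?_ ?_ ?_ ?_ hh
  · rintro _ ⟨j, hj, rfl⟩
    refine ⟨j, hj, fun h' j' h1 h2 => ?_⟩
    refine (isBigO_zero _ _).congr' ?_ EventuallyEq.rfl
    filter_upwards [Germ.coe_eq.1 (h1.symm.trans h2 : (h' : FunGerm k n) = j')] with x hx
    rw [hx, sub_self]
  · refine ⟨0, J.zero_mem, fun h' j' h1 h2 => ?_⟩
    refine (isBigO_zero _ _).congr' ?_ EventuallyEq.rfl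
    filter_upwards [h1.eventually_eq IsRep.zero, h2.eventually_eq IsRep.zero] with x hx hx'
    rw [hx, hx', sub_self]
  · rintro a b - - ⟨i, hi, hai⟩ ⟨j, hj, hbj⟩
    refine ⟨i + j, J.add_mem hi hj, fun h' j' h1 h2 => ?_⟩
    obtain ⟨a', -, ha'⟩ := exists_isRep a
    obtain ⟨b', -, hb'⟩ := exists_isRep b
    obtain ⟨i', -, hi'⟩ := rationalGerms_le_analyticGerms i.2
    obtain ⟨j'', -, hj''⟩ := rationalGerms_le_analyticGerms j.2
    refine ((hai a' i' ha' hi').add (hbj b' j'' hb' hj'')).congr' ?_ EventuallyEq.rfl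
    filter_upwards [h1.eventually_eq (ha'.add hb'),
      h2.eventually_eq (IsRep.add hi' hj'')] with x hx hx'
    rw [hx, hx']; ring
  · rintro a b - ⟨j, hj, hbj⟩
    obtain ⟨a', haa, ha'⟩ := exists_isRep a
    obtain ⟨b', -, hb'⟩ := exists_isRep b
    obtain ⟨j'', hja, hj''⟩ := rationalGerms_le_analyticGerms j.2
    obtain ⟨P, hP⟩ := exists_mvPolynomial_isBigO haa N
    refine ⟨polynomialGerm P * j, J.mul_mem_left _ hj, fun h' j' h1 h2 => ?_⟩
    have h3 : a' =O[𝓝 0] fun _ => (1 : ℝ) := haa.continuousAt.tendsto.isBigO_one ℝ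
    have h4 : j'' =O[𝓝 0] fun _ => (1 : ℝ) := hja.continuousAt.tendsto.isBigO_one ℝ
    have h5 := ((h3.mul (hbj b' j'' hb' hj'')).congr_right fun x => one_mul _).add
      ((hP.mul h4).congr_right fun x => mul_one _)
    refine h5.congr' ?_ EventuallyEq.rfl
    filter_upwards [h1.eventually_eq (ha'.mul hb'),
      h2.eventually_eq ((isRep_polynomialGerm P).mul hj'')] with x hx hx'
    rw [hx, hx']; ring

end Rational

/-! ### Units among the analytic germs -/

section Analytic

variable {k : Type*} [NontriviallyNormedField k] {n : ℕ}

theorem isUnit_of_mem_analyticGerms {a : analyticGerms k n} (ha : germValue a.val ≠ 0) :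
    IsUnit a := by
  obtain ⟨_, g, hg, rfl⟩ := a
  have hg0 : g 0 ≠ 0 := ha
  refine IsUnit.of_mul_eq_one ⟨_, _, hg.inv hg0, rfl⟩ (Subtype.ext (Germ.coe_eq.2 ?_))
  filter_upwards [hg.continuousAt.eventually_ne hg0] with x hx
  exact mul_inv_cancel₀ hx

end Analytic

end DetRep

/-! ### Uniqueness of maximally generated representations over the three rings -/

theorem mainTheorem11 {k : Type*} [NontriviallyNormedField k] [CompleteSpace k] [IsAlgClosed k]
    [CharZero k] (n r : ℕ) :
    -- rational functions regular at the origin, and locally converging power series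
    (∀ O : Subring (DetRep.FunGerm k n),
      (O = DetRep.rationalGerms k n ∨ O = DetRep.analyticGerms k n) →
      ∀ f : Fin r → O,
        (∀ α, DetRep.GermSmooth (f α).val) →
        (∀ α β, α ≠ β → DetRep.GermNonTangent (f α).val (f β).val) →
        (DetRep.IsDetRep (fun a : O => DetRep.germValue a.val) (∏ α, f α) (Matrix.diagonal f) ∧
          DetRep.GermMaxGenNear ((Matrix.diagonal f).map O.subtype)) ∧
        ∀ (d : ℕ) (M : Matrix (Fin d) (Fin d) O),
          DetRep.IsDetRep (fun a : O => DetRep.germValue a.val) (∏ α, f α) M →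
          DetRep.GermMaxGenNear (M.map O.subtype) →
          DetRep.LocallyEquivalent M (Matrix.diagonal f)) ∧
    -- formal power series
    (∀ f : Fin r → MvPowerSeries (Fin n) k,
        (∀ α, DetRep.FormalSmooth (f α)) →
        (∀ α β, α ≠ β → DetRep.FormalNonTangent (f α) (f β)) →
        (DetRep.IsDetRep (fun a : MvPowerSeries (Fin n) k => MvPowerSeries.constantCoeff a)
            (∏ α, f α) (Matrix.diagonal f) ∧
          DetRep.SpecMaxGen (Matrix.diagonal f)) ∧
        ∀ (d : ℕ) (M : Matrix (Fin d) (Fin d) (MvPowerSeries (Fin n) k)),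
          DetRep.IsDetRep (fun a : MvPowerSeries (Fin n) k => MvPowerSeries.constantCoeff a)
            (∏ α, f α) M →
          DetRep.SpecMaxGen M →
          DetRep.LocallyEquivalent M (Matrix.diagonal f)) := by
  refine ⟨?_, fun f hf hfg => ⟨⟨DetRep.isDetRep_diagonal (map_zero _) fun a => (hf a).1,
    DetRep.specMaxGen_diagonal hf⟩, fun d M hM hgen =>
      DetRep.formal_locallyEquivalent_diagonal hf hfg hM hgen⟩⟩
  rintro O (rfl | rfl) f hf hfg
  · exact ⟨⟨DetRep.isDetRep_diagonal (map_zero (DetRep.valueHom _)) fun a => (hf a).1,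
      DetRep.germMaxGenNear_diagonal DetRep.rationalGerms_le_analyticGerms hf⟩,
      fun d M hM hgen => DetRep.germ_locallyEquivalent_diagonal
        DetRep.rationalGerms_le_analyticGerms (fun a => DetRep.isUnit_of_mem_rationalGerms)
        DetRep.mem_of_inclusion_mem_map hf hfg hM hgen⟩
  · refine ⟨⟨DetRep.isDetRep_diagonal (map_zero (DetRep.valueHom _)) fun a => (hf a).1,
      DetRep.germMaxGenNear_diagonal le_rfl hf⟩,
      fun d M hM hgen => DetRep.germ_locallyEquivalent_diagonal le_rfl
        (fun a => DetRep.isUnit_of_mem_analyticGerms) (fun J g hg => ?_) hf hfg hM hgen⟩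
    have hid : Subring.inclusion (le_refl (DetRep.analyticGerms k n)) = RingHom.id _ := rfl
    rwa [hid, Ideal.map_id] at hg
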